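/- **Setting.** Let $N\ge 2$ and write $\mathbf x=(\widetilde{\mathbf x},z)\in\mathbb R^{N-1}\times\mathbb R$. Let $G,G_0\subset\mathbb R^{N-1}$ be bounded, open, connected and nonempty with $\overline G\subset G_0$, let $\zeta\in C^2(G_0)$ be real-valued, and put $$\Gamma=\{(\widetilde{\mathbf x},\zeta(\widetilde{\mathbf x})):\widetilde{\mathbf x}\in G\},\qquad \Omega_2=\{(\widetilde{\mathbf x},z):\widetilde{\mathbf x}\in G,\ \zeta(\widetilde{\mathbf x})<z<\zeta(\widetilde{\mathbf x})+1\},\qquad \Gamma+1=\{(\widetilde{\mathbf x},\zeta(\widetilde{\mathbf x})+1):\widetilde{\mathbf x}\in G\}.$$ Let $\Omega_1\subset\mathbb R^N$ be a bounded domain, disjoint from $\Omega_2$, with $\partial\Omega_1\cap\partial\Omega_2=\overline\Gamma$ and such that $\Omega=\Omega_1\cup\Gamma\cup\Omega_2$ is open. Let $\widehat{\mathbf n}$ be the upward unit normal to $\Gamma$ (a function of $\widetilde{\mathbf x}$ only), and let $\widehat{\boldsymbol\nu}_1,\dots,\widehat{\boldsymbol\nu}_{N-1}$ be $C^1$ fields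 on $G$ that form, together with $\widehat{\mathbf n}$, an orthonormal basis of $\mathbb R^N$ at each point. For a field $\mathbf w$ on $\Omega$ write $\mathbf w^i=\mathbf w|_{\Omega_i}$; $\mathbf w_T$ and $\mathbf w_N$ are the first $N-1$ components and the last one, $\mathbf w^2_{\mathbf n}=\mathbf w^2\cdot\widehat{\mathbf n}$ and $\mathbf w^2_{\tau}=(\mathbf w^2\cdot\widehat{\boldsymbol\nu}_i)_{i<N}$. Let $\nabla_T$ be the gradient in the first $N-1$ variables, and, for $\epsilon>0$, $$\mathbf D^\epsilon\mathbf w=\nabla_T\mathbf w+\Big(1-\frac1\epsilon\Big)\,\partial_z\mathbf w\,(\nabla_T\zeta)\in\mathbb R^{N\times(N-1)} .$$ Let $\mathbf X$ be the space of all $\mathbf v\in \mathbf H_{\rm div}(\Omega)$ such that $\mathbf v^2\in [H^1(\Omega_2)]^N$, $\mathbf v^2=0$ on the lateral wall $\{(\widetilde{\mathbf x},z):\widetilde{\mathbf x}\in\partial G,\ \zeta(\widetilde{\mathbf x})<z<\zeta(\widetilde{\mathbf x})+1\}$ (that is, $\mathbf v^2$ is an $H^1(\Omega_2)$-limit of smooth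 fields vanishing near the lateral wall) and $\mathbf v^2\cdot\widehat{\mathbf n}=0$ on $\Gamma+1$; in particular $\mathbf v^1\cdot\widehat{\mathbf n}=\mathbf v^2\cdot\widehat{\mathbf n}$ on $\Gamma$. Let $\mathbf Y=L^2(\Omega)$. The viscosity $\mu>0$ is constant, $\alpha,\beta\ge0$ are bounded measurable functions on $\Gamma$, and $\mathcal Q$ is a measurable, bounded, symmetric tensor field on $\Omega_1\cup\Gamma$ with $(\mathcal Q\boldsymbol\xi)\cdot\boldsymbol\xi\ge C_{\mathcal Q}|\boldsymbol\xi|^2$ for all $\boldsymbol\xi\in\mathbb R^N$ and some $C_{\mathcal Q}>0$. On tangential components, $\sqrt{\mathcal Q}$ acts through the matrix $(\sqrt{\mathcal Q}\,\widehat{\boldsymbol\nu}_j\cdot\widehat{\boldsymbol\nu}_i)_{i,j<N}$. The forcing terms $\mathbf f^{2,\epsilon}\in \mathbf L^2(\Omega_2)$ and $h^{1,\epsilon}\in L^2(\Omega_1)$, $\epsilon>0$, satisfy $\|\mathbf f^{2,\epsilon}\|_{0,\Omega_2}\le C$ and $\|h^{1,\epsilon}\|_{0,\Omega_1}\le C$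 for all $\epsilon>0$. For $q\in\mathbf Y$, $\mathbf w\in\mathbf X$ put $$b_\epsilon(q,\mathbf w)=\epsilon\int_{\Omega_2}q\,\nabla_T\!\cdot\mathbf w_T^2+\epsilon\Big(1-\frac1\epsilon\Big)\int_{\Omega_2}q\,\partial_z\mathbf w_T^2\cdot\nabla_T\zeta+\int_{\Omega_2}q\,\partial_z\mathbf w_N^2 .$$ The rescaled $\epsilon$-problem on the fixed reference domain is: find $[\mathbf v^\epsilon,p^\epsilon]\in\mathbf X\times\mathbf Y$ such that for all $[\mathbf w,\varphi]\in\mathbf X\times\mathbf Y$ $$\int_{\Omega_1}\mathcal Q\mathbf v^{1,\epsilon}\cdot\mathbf w^1-\int_{\Omega_1}p^{1,\epsilon}\,\nabla\!\cdot\mathbf w^1-b_\epsilon(p^{\epsilon},\mathbf w)+\epsilon^2\int_{\Omega_2}\mu\,\mathbf D^\epsilon\mathbf v^{2,\epsilon}:\mathbf D^\epsilon\mathbf w^2+\int_{\Omega_2}\mu\,\partial_z\mathbf v_T^{2,\epsilon}\cdot\partial_z\mathbf w_T^2+\int_{\Omega_2}\mu\,\partial_z\mathbf v_N^{2,\epsilon}\,\partial_z\mathbf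 w_N^2$$ $$+\int_\Gamma\alpha\,(\mathbf v^{1,\epsilon}\cdot\widehat{\mathbf n})(\mathbf w^1\cdot\widehat{\mathbf n})\,dS+\epsilon^2\int_\Gamma\beta\sqrt{\mathcal Q}\,\mathbf v_\tau^{2,\epsilon}\cdot\mathbf w_\tau^2\,dS=\epsilon\int_{\Omega_2}\mathbf f^{2,\epsilon}\cdot\mathbf w^2,$$ $$\int_{\Omega_1}\nabla\!\cdot\mathbf v^{1,\epsilon}\,\varphi+b_\epsilon(\varphi,\mathbf v^{\epsilon})=\int_{\Omega_1}h^{1,\epsilon}\varphi .$$ **Theorem (Global a-priori Estimate).** Consider the estimate $$\|\mathbf v^{1,\epsilon}\|^2_{0,\Omega_1}+\|\mathbf D^\epsilon(\epsilon\mathbf v^{2,\epsilon})\|^2_{0,\Omega_2}+\|\partial_z\mathbf v_T^{2,\epsilon}\|^2_{0,\Omega_2}+\|\partial_z\mathbf v_N^{2,\epsilon}\|^2_{0,\Omega_2}+\|\mathbf v_{\mathbf n}^{2,\epsilon}\|^2_{0,\Gamma}+\|\epsilon\mathbf v_\tau^{2,\epsilon}\|^2_{0,\Gamma}\le K .\tag{$*$}$$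 1. For every $\epsilon_0>0$ there is a constant $K>0$ such that $(*)$ holds for every $\epsilon\in(0,\epsilon_0]$ and every solution $[\mathbf v^\epsilon,p^\epsilon]$ of the $\epsilon$-problem. 2. If moreover $\beta\ge b$ almost everywhere on $\Gamma$ for some constant $b>0$, then there is a constant $K>0$ such that $(*)$ holds for every $\epsilon>0$ and every solution $[\mathbf v^\epsilon,p^\epsilon]$ of the $\epsilon$-problem. -/

import Mathlib

open MeasureTheory Filter Topology
open scoped ContDiff MatrixOrder

noncomputable section

namespace DarcyStokes

/-- `ℝⁿ` with its Euclidean norm. Throughout, the ambient space is `ℝᴺ` with `N = d + 1`; the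
index `Fin.last d` is the vertical direction `z` and the indices `j.castSucc` (`j : Fin d`) are
the first `N - 1` directions. -/
abbrev Vec (n : ℕ) : Type := EuclideanSpace ℝ (Fin n)

variable {d : ℕ}

/-! ### Geometry -/

/-- The horizontal part `x̃` of a point `x = (x̃, x_N)`. -/
def hor (x : Vec (d + 1)) : Vec d := WithLp.toLp 2 fun j => x j.castSucc

/-- The point `(y, t)` of `ℝᴺ`. -/
def mkPt (y : Vec d) (t : ℝ) : Vec (d + 1) :=
  WithLp.toLp 2 (Fin.snoc (α := fun _ => ℝ) (fun j => y j) t)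

/-- The graph `{(y, ζ y) : y ∈ G}`, that is, the interface `Γ`. -/
def graphSurface (ζ : Vec d → ℝ) (G : Set (Vec d)) : Set (Vec (d + 1)) :=
  (fun y => mkPt y (ζ y)) '' G

/-- The cylinder `{(y, t) : y ∈ G, ζ y < t < ζ y + ε}` of height `ε` over the graph. -/
def channel (ζ : Vec d → ℝ) (G : Set (Vec d)) (ε : ℝ) : Set (Vec (d + 1)) :=
  {x | hor x ∈ G ∧ ζ (hor x) < x (Fin.last d) ∧ x (Fin.last d) < ζ (hor x) + ε}

/-- The geometric setting on the fixed domain of reference (channel of height one). -/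
structure Geometry (d : ℕ) where
  G₀ : Set (Vec d)
  G : Set (Vec d)
  ζ : Vec d → ℝ
  /-- the porous medium -/
  Ω₁ : Set (Vec (d + 1))
  isOpen_G₀ : IsOpen G₀
  isConnected_G₀ : IsConnected G₀
  isBounded_G₀ : Bornology.IsBounded G₀
  isOpen_G : IsOpen G
  isConnected_G : IsConnected G
  isBounded_G : Bornology.IsBounded G
  closure_G_subset : closure G ⊆ G₀
  contDiffOn_ζ : ContDiffOn ℝ 2 ζ G₀
  isOpen_Ω₁ : IsOpen Ω₁
  isConnected_Ω₁ : IsConnected Ω₁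
  isBounded_Ω₁ : Bornology.IsBounded Ω₁
  disjoint_channel : Disjoint Ω₁ (channel ζ G 1)
  /-- the two regions meet exactly along the interface (and its rim) -/
  frontier_inter : frontier Ω₁ ∩ frontier (channel ζ G 1) = closure (graphSurface ζ G)
  /-- the porous medium lies on the other side of the interface, so that
  `Ω₁ ∪ Γ ∪ Ω₂` is again a domain -/
  isOpen_union : IsOpen (Ω₁ ∪ graphSurface ζ G ∪ channel ζ G 1)

namespace Geometry

/-- The interface `Γ`. -/
def Γ (g : Geometry d) : Set (Vec (d + 1)) := graphSurface g.ζ g.G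

/-- The channel of reference `Ω₂`. -/
def Ω₂ (g : Geometry d) : Set (Vec (d + 1)) := channel g.ζ g.G 1

/-- The domain of reference `Ω = Ω₁ ∪ Γ ∪ Ω₂`. -/
def Ω (g : Geometry d) : Set (Vec (d + 1)) := g.Ω₁ ∪ g.Γ ∪ g.Ω₂

/-- The upward unit normal `(-∇ζ, 1) / √(1 + |∇ζ|²)` to `Γ` at the point above `y`. -/
def normal (g : Geometry d) (y : Vec d) : Vec (d + 1) :=
  (Real.sqrt (1 + ‖gradient g.ζ y‖ ^ 2))⁻¹ • mkPt (-gradient g.ζ y) 1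

/-- Surface measure of `Γ` in the parametrization `y ↦ (y, ζ y)`: functions on `Γ` are written as
functions of `y ∈ G` and `dS = √(1 + |∇ζ|²) dy`. -/
def surfaceMeasure (g : Geometry d) : Measure (Vec d) :=
  (volume.restrict g.G).withDensity fun y =>
    ENNReal.ofReal (Real.sqrt (1 + ‖gradient g.ζ y‖ ^ 2))

/-- A stream line localizer: a `C¹` field of orthonormal bases `(ν₁, …, ν_{N-1}, n)` of `ℝᴺ`,
given by its tangent vectors. -/
structure Localizer (g : Geometry d) where
  ν : Fin d → Vec d → Vec (d + 1)
  contDiffOn_ν : ∀ i, ContDiffOn ℝ 1 (ν i) g.G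
  orthonormal_ν : ∀ y ∈ g.G, Orthonormal ℝ fun i => ν i y
  inner_normal : ∀ y ∈ g.G, ∀ i, inner ℝ (ν i y) (g.normal y) = 0

/-! ### Function spaces -/

/-- `q` is the weak divergence of `v` in the open set `Ω`. -/
def _root_.DarcyStokes.IsWeakDiv {n : ℕ} (Ω : Set (Vec n)) (v : Vec n → Vec n)
    (q : Vec n → ℝ) : Prop :=
  ∀ φ : Vec n → ℝ, ContDiff ℝ ∞ φ → HasCompactSupport φ → tsupport φ ⊆ Ω →
    ∫ x in Ω, inner ℝ (v x) (gradient φ x) = -∫ x in Ω, q x * φ x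

/-- The entry `∂_j w_i (x)` of the classical gradient of a smooth vector field. -/
def _root_.DarcyStokes.partialDeriv {n : ℕ} (w : Vec n → Vec n) (x : Vec n) (i j : Fin n) : ℝ :=
  (fderiv ℝ w x (EuclideanSpace.single j 1)) i

/-- `w ∈ H¹(Ω₂)ᴺ` vanishes on the lateral wall of `Ω₂`, with weak gradient `Dw`, and
`γ₀`, `γ₁` are its traces on `Γ` and on `Γ + 1` (as functions of `y ∈ G`).
The space of such fields is the `H¹(Ω₂)`-closure of the smooth fields that vanish near the lateral
wall, and the traces are the continuous extensions, from that dense class, of the restriction to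
the two surfaces. -/
def IsLateralH1 (g : Geometry d) (w : Vec (d + 1) → Vec (d + 1))
    (Dw : Vec (d + 1) → Matrix (Fin (d + 1)) (Fin (d + 1)) ℝ)
    (γ₀ γ₁ : Vec d → Vec (d + 1)) : Prop :=
  MemLp w 2 (volume.restrict g.Ω₂) ∧
  (∀ i j, MemLp (fun x => Dw x i j) 2 (volume.restrict g.Ω₂)) ∧
  MemLp γ₀ 2 (volume.restrict g.G) ∧
  MemLp γ₁ 2 (volume.restrict g.G) ∧
  ∃ φ : ℕ → Vec (d + 1) → Vec (d + 1),
    (∀ n, ContDiff ℝ ∞ (φ n) ∧ HasCompactSupport (φ n) ∧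
      tsupport (φ n) ⊆ {x | hor x ∈ g.G}) ∧
    Tendsto (fun n => eLpNorm (fun x => φ n x - w x) 2 (volume.restrict g.Ω₂)) atTop (𝓝 0) ∧
    (∀ i j, Tendsto
      (fun n => eLpNorm (fun x => partialDeriv (φ n) x i j - Dw x i j) 2 (volume.restrict g.Ω₂))
      atTop (𝓝 0)) ∧
    Tendsto (fun n => eLpNorm (fun y => φ n (mkPt y (g.ζ y)) - γ₀ y) 2 (volume.restrict g.G))
      atTop (𝓝 0) ∧
    Tendsto (fun n => eLpNorm (fun y => φ n (mkPt y (g.ζ y + 1)) - γ₁ y) 2 (volume.restrict g.G))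
      atTop (𝓝 0)

/-- An element of the velocity space
`X = {v ∈ H_div(Ω) : v|_{Ω₂} ∈ X₂}`, where `X₂` consists of the fields in `H¹(Ω₂)ᴺ` that vanish on
the lateral wall and have zero normal component on `Γ + 1`. Since `v ∈ H_div(Ω)`, the normal traces
of `v¹ = v|_{Ω₁}` and `v² = v|_{Ω₂}` agree on `Γ`. The divergence, gradient and traces, which are
determined by `v` almost everywhere, are carried along. -/
structure Velocity (g : Geometry d) where
  val : Vec (d + 1) → Vec (d + 1)
  /-- weak divergence in `Ω` -/
  div : Vec (d + 1) → ℝ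
  /-- weak gradient in `Ω₂`, `grad x i j = ∂_j v_i (x)` -/
  grad : Vec (d + 1) → Matrix (Fin (d + 1)) (Fin (d + 1)) ℝ
  /-- trace of `v²` on `Γ` -/
  trace : Vec d → Vec (d + 1)
  /-- trace of `v²` on `Γ + 1` -/
  topTrace : Vec d → Vec (d + 1)
  memLp_val : MemLp val 2 (volume.restrict g.Ω)
  memLp_div : MemLp div 2 (volume.restrict g.Ω)
  isWeakDiv : IsWeakDiv g.Ω val div
  isLateralH1 : g.IsLateralH1 val grad trace topTrace
  topTrace_normal : ∀ᵐ y ∂volume.restrict g.G, inner ℝ (topTrace y) (g.normal y) = 0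

/-- Normal component `v_n = v² · n` on `Γ`; it equals `v¹ · n` for elements of `X`. -/
def Velocity.normalTrace {g : Geometry d} (v : g.Velocity) (y : Vec d) : ℝ :=
  inner ℝ (v.trace y) (g.normal y)

/-- Tangential components `v_τ = (v² · ν_i)_i` on `Γ`. -/
def Velocity.tangTrace {g : Geometry d} (v : g.Velocity) (L : g.Localizer) (y : Vec d)
    (i : Fin d) : ℝ :=
  inner ℝ (v.trace y) (L.ν i y)

/-! ### The rescaled problem -/

/-- The operator `D^ε w = ∇_T w + (1 - 1/ε) ∂_z w ∇_T ζ ∈ ℝ^{N × (N-1)}`, where `A` is the gradient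
of `w` at `x`. -/
def Deps (g : Geometry d) (ε : ℝ) (A : Matrix (Fin (d + 1)) (Fin (d + 1)) ℝ)
    (x : Vec (d + 1)) : Matrix (Fin (d + 1)) (Fin d) ℝ :=
  fun i j => A i j.castSucc + (1 - 1 / ε) * A i (Fin.last d) * gradient g.ζ (hor x) j

/-- Contraction `σ : κ = ∑ σ_{ij} κ_{ij}`. -/
def _root_.DarcyStokes.contract {m n : ℕ} (σ κ : Matrix (Fin m) (Fin n) ℝ) : ℝ :=
  ∑ i, ∑ j, σ i j * κ i j

/-- The integrand `(Q x) · y`. -/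
def _root_.DarcyStokes.form {n : ℕ} (A : Matrix (Fin n) (Fin n) ℝ) (x y : Vec n) : ℝ :=
  inner ℝ (Matrix.toEuclideanLin A x) y

/-- The physical coefficients: the viscosity `μ > 0`, the fluid entry resistance `α` and the
coefficient `β` (functions on `Γ`, nonnegative and essentially bounded), and the symmetric, bounded,
uniformly elliptic tensor `Q`. -/
structure Coefficients (g : Geometry d) where
  μ : ℝ
  α : Vec d → ℝ
  β : Vec d → ℝ
  Q : Vec (d + 1) → Matrix (Fin (d + 1)) (Fin (d + 1)) ℝ
  μ_pos : 0 < μ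
  aemeasurable_α : AEMeasurable α (volume.restrict g.G)
  aemeasurable_β : AEMeasurable β (volume.restrict g.G)
  α_nonneg : ∀ᵐ y ∂volume.restrict g.G, 0 ≤ α y
  β_nonneg : ∀ᵐ y ∂volume.restrict g.G, 0 ≤ β y
  α_bounded : ∃ M : ℝ, ∀ᵐ y ∂volume.restrict g.G, α y ≤ M
  β_bounded : ∃ M : ℝ, ∀ᵐ y ∂volume.restrict g.G, β y ≤ M
  measurable_Q : ∀ i j, Measurable fun x => Q x i j
  Q_bounded : ∃ M : ℝ, ∀ x ∈ g.Ω₁ ∪ g.Γ, ∀ i j, |Q x i j| ≤ M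
  Q_symm : ∀ x ∈ g.Ω₁ ∪ g.Γ, (Q x).IsSymm
  Q_elliptic : ∃ c : ℝ, 0 < c ∧ ∀ x ∈ g.Ω₁ ∪ g.Γ, ∀ ξ : Vec (d + 1), c * ‖ξ‖ ^ 2 ≤ form (Q x) ξ ξ

/-- The matrix of `√Q`, restricted to the tangent plane of `Γ`, in the basis `ν₁, …, ν_{N-1}`:
it acts on tangential components `v_τ ∈ ℝ^{N-1}` in such a way that
`(√Q v_τ) · w_τ = (√Q v(τ)) · w(τ)` with `v(τ) = v - (v · n) n`. -/
def Coefficients.sqrtTang {g : Geometry d} (c : g.Coefficients) (L : g.Localizer) (y : Vec d) :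
    Matrix (Fin d) (Fin d) ℝ :=
  fun i j => form (CFC.sqrt (c.Q (mkPt y (g.ζ y)))) (L.ν j y) (L.ν i y)

/-- The rescaled divergence on the channel,
`ε ∇_T · w_T + ε (1 - 1/ε) ∂_z w_T · ∇_T ζ + ∂_z w_N`, enters the problem through the integrals of
these three terms against a scalar `q`. -/
def divIntegral (g : Geometry d) (ε : ℝ) (q : Vec (d + 1) → ℝ) (w : g.Velocity) : ℝ :=
  ε * (∫ x in g.Ω₂, q x * ∑ j : Fin d, w.grad x j.castSucc j.castSucc)
  + ε * (1 - 1 / ε) * (∫ x in g.Ω₂,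
      q x * ∑ j : Fin d, w.grad x j.castSucc (Fin.last d) * gradient g.ζ (hor x) j)
  + ∫ x in g.Ω₂, q x * w.grad x (Fin.last d) (Fin.last d)

/-- `[v, p] ∈ X × Y` is a solution of the rescaled `ε`-problem on the fixed domain of reference,
with forcing terms `f` on `Ω₂` and `h` on `Ω₁`. -/
structure IsSolution (g : Geometry d) (c : g.Coefficients) (L : g.Localizer) (ε : ℝ)
    (f : Vec (d + 1) → Vec (d + 1)) (h : Vec (d + 1) → ℝ)
    (v : g.Velocity) (p : Vec (d + 1) → ℝ) : Prop where
  memLp_p : MemLp p 2 (volume.restrict g.Ω)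
  momentum : ∀ w : g.Velocity,
    (∫ x in g.Ω₁, form (c.Q x) (v.val x) (w.val x))
    - (∫ x in g.Ω₁, p x * w.div x)
    - g.divIntegral ε p w
    + ε ^ 2 * (∫ x in g.Ω₂, c.μ * contract (g.Deps ε (v.grad x) x) (g.Deps ε (w.grad x) x))
    + (∫ x in g.Ω₂, c.μ *
        ∑ j : Fin d, v.grad x j.castSucc (Fin.last d) * w.grad x j.castSucc (Fin.last d))
    + (∫ x in g.Ω₂, c.μ *
        (v.grad x (Fin.last d) (Fin.last d) * w.grad x (Fin.last d) (Fin.last d)))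
    + (∫ y, c.α y * (v.normalTrace y * w.normalTrace y) ∂g.surfaceMeasure)
    + ε ^ 2 * (∫ y, c.β y *
        ∑ i, (∑ j, c.sqrtTang L y i j * v.tangTrace L y j) * w.tangTrace L y i ∂g.surfaceMeasure)
    = ε * ∫ x in g.Ω₂, inner ℝ (f x) (w.val x)
  mass : ∀ φ : Vec (d + 1) → ℝ, MemLp φ 2 (volume.restrict g.Ω) →
    (∫ x in g.Ω₁, v.div x * φ x) + g.divIntegral ε φ v = ∫ x in g.Ω₁, h x * φ x

/-- The sum of squared norms
`‖v¹‖² + ‖D^ε(ε v²)‖² + ‖∂_z v²_T‖² + ‖∂_z v²_N‖² + ‖v²_n‖²_Γ + ‖ε v²_τ‖²_Γ`. -/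
def energy (g : Geometry d) (L : g.Localizer) (ε : ℝ) (v : g.Velocity) : ℝ :=
  (∫ x in g.Ω₁, ‖v.val x‖ ^ 2)
  + (∫ x in g.Ω₂, ∑ i, ∑ j, (g.Deps ε (ε • v.grad x) x i j) ^ 2)
  + (∫ x in g.Ω₂, ∑ j : Fin d, (v.grad x j.castSucc (Fin.last d)) ^ 2)
  + (∫ x in g.Ω₂, (v.grad x (Fin.last d) (Fin.last d)) ^ 2)
  + (∫ y, (v.normalTrace y) ^ 2 ∂g.surfaceMeasure)
  + ∫ y, ∑ i, (ε * v.tangTrace L y i) ^ 2 ∂g.surfaceMeasure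

end Geometry

end DarcyStokes

end

/-!
The estimate is the energy identity obtained by testing the momentum equation with the solution `v`
itself and the mass equation with `p`: the pressure terms of the momentum equation turn into the
work of the source, and the dissipation, friction included, equals `ε ∫ f · v² + ∫ h p¹`. It remains to absorb these two terms and to recover the traces.

*The forcing term.* In the flattened coordinates `(y, t) ↦ (y, ζ y + t)` of the channel one has
`D^ε(ε v) = ε ∇_y v - ∂_z v ⊗ ∇ζ`. Hence `ε ∇_y v` is controlled by the dissipation for every
`ε > 0`, with a constant that does not depend on `ε`, and so is `ε v` by Poincaré's inequality on
the slices of the channel, as `v` vanishes on the lateral wall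
(`Geometry.exists_sq_mul_integral_sq_le`).

*The pressure.* A field of the form `W e_N` supported in `Ω₁`, with divergence `p` and without flux
through `Γ`, is an admissible test function for which all terms of the channel disappear; this
bounds `p¹` by `v¹` (`Geometry.Coefficients.exists_integral_pressure_sq_le`). No regularity of `∂Ω₁`
is needed for the existence of `W`: by duality (`exists_inner_eq_of_abs_le`) it amounts to the
vertical Poincaré inequality on `Ω₁` for functions that vanish near `∂Ω` but not on `Γ`
(`Geometry.exists_eLpNorm_le_vertical`). That inequality holds since a ray going down from a point
of `Ω₁` cannot leave `Ω₁` through `Γ`. Both Poincaré inequalities are instances of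
`lintegral_sq_le_directional`.

*The traces.* The normal does not depend on the height and `v² · n` vanishes on `Γ + 1`, so that
`∂_z v` controls the normal trace. The tangential trace of `ε v` is controlled by `ε v` and
`ε ∂_z v`, which suffices for bounded `ε`; when `β ≥ b > 0`, the friction term controls it for
all `ε`, as `√Q` is bounded below (`le_form_sqrt`) and measurable (`exists_measurable_sqrt`).
-/

namespace DarcyStokes

/-! ### Square-integrable functions -/

section SquareIntegrable

variable {α E F : Type*} [MeasurableSpace α] {μ : Measure α}
  [NormedAddCommGroup E] [NormedAddCommGroup F]

/-- The Cauchy-Schwarz inequality against the constant function one. -/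
theorem sq_lintegral_le (f : α → ENNReal) (hf : AEMeasurable f μ) :
    (∫⁻ a, f a ∂μ) ^ 2 ≤ μ Set.univ * ∫⁻ a, f a ^ 2 ∂μ := by
  have h := ENNReal.lintegral_mul_le_Lp_mul_Lq μ Real.HolderConjugate.two_two hf
    (aemeasurable_const (b := (1 : ENNReal)))
  simp only [Pi.mul_apply, mul_one, ENNReal.one_rpow, lintegral_const, one_mul] at h
  calc _ ≤ _ := pow_le_pow_left' h 2
    _ = _ := by
      rw [mul_pow, ← ENNReal.rpow_natCast, ← ENNReal.rpow_natCast, ← ENNReal.rpow_mul,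
        ← ENNReal.rpow_mul]
      norm_num
      rw [mul_comm]

theorem eLpNorm_two_sq (f : α → E) : eLpNorm f 2 μ ^ 2 = ∫⁻ a, ‖f a‖ₑ ^ 2 ∂μ := by
  rw [eLpNorm_eq_lintegral_rpow_enorm_toReal (by norm_num) (by norm_num), ← ENNReal.rpow_natCast,
    ← ENNReal.rpow_mul]
  norm_num

theorem integral_norm_sq_eq_toReal {f : α → E} (hf : AEStronglyMeasurable f μ) :
    ∫ a, ‖f a‖ ^ 2 ∂μ = (eLpNorm f 2 μ).toReal ^ 2 := by
  rw [← ENNReal.toReal_pow, eLpNorm_two_sq, integral_eq_lintegral_of_nonneg_ae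
    (f := fun a => ‖f a‖ ^ 2) (Eventually.of_forall fun a => by positivity) (hf.norm.pow 2)]
  congr 1
  refine lintegral_congr fun a => ?_
  rw [ENNReal.ofReal_pow (norm_nonneg _), ofReal_norm]

theorem integral_norm_sq_le_of_eLpNorm_le {f : α → E} {C : ℝ} (hC : 0 ≤ C) (hf : MemLp f 2 μ)
    (h : eLpNorm f 2 μ ≤ ENNReal.ofReal C) : ∫ a, ‖f a‖ ^ 2 ∂μ ≤ C ^ 2 := by
  rw [integral_norm_sq_eq_toReal hf.1]
  exact pow_le_pow_left₀ ENNReal.toReal_nonneg (ENNReal.toReal_le_of_le_ofReal hC h) 2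

theorem integral_norm_sq_le_mul {β : Type*} [MeasurableSpace β] {ν : Measure β}
    {f : α → E} {g : β → F} {R : ℝ} (hR : 0 ≤ R) (hf : MemLp f 2 μ) (hg : MemLp g 2 ν)
    (hle : eLpNorm f 2 μ ≤ ENNReal.ofReal R * eLpNorm g 2 ν) :
    ∫ a, ‖f a‖ ^ 2 ∂μ ≤ R ^ 2 * ∫ a, ‖g a‖ ^ 2 ∂ν := by
  rw [integral_norm_sq_eq_toReal hf.1, integral_norm_sq_eq_toReal hg.1, ← mul_pow]
  refine pow_le_pow_left₀ ENNReal.toReal_nonneg ?_ 2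
  calc _ ≤ _ := ENNReal.toReal_mono (ENNReal.mul_ne_top ENNReal.ofReal_ne_top hg.eLpNorm_ne_top) hle
    _ = _ := by rw [ENNReal.toReal_mul, ENNReal.toReal_ofReal hR]

theorem tendsto_eLpNorm_of_tendsto_sub {f : α → E} {φ : ℕ → α → E} (hf : MemLp f 2 μ)
    (hφ : ∀ n, AEStronglyMeasurable (φ n) μ)
    (h : Tendsto (fun n => eLpNorm (fun x => φ n x - f x) 2 μ) atTop (𝓝 0)) :
    Tendsto (fun n => eLpNorm (φ n) 2 μ) atTop (𝓝 (eLpNorm f 2 μ)) := by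
  have h0 := hf.eLpNorm_ne_top
  have hu : ∀ n, eLpNorm (φ n) 2 μ ≤ eLpNorm f 2 μ + eLpNorm (fun x => φ n x - f x) 2 μ := by
    intro n
    have := eLpNorm_add_le hf.1 ((hφ n).sub hf.1) (p := 2) (by norm_num)
    rwa [add_sub_cancel] at this
  have hl : ∀ n, eLpNorm f 2 μ - eLpNorm (fun x => φ n x - f x) 2 μ ≤ eLpNorm (φ n) 2 μ := by
    intro n
    have := eLpNorm_sub_le (hφ n) ((hφ n).sub hf.1) (p := 2) (by norm_num)
    rw [sub_sub_cancel] at this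
    exact tsub_le_iff_right.2 this
  refine tendsto_of_tendsto_of_tendsto_of_le_of_le ?_ ?_ hl hu
  · simpa using ENNReal.Tendsto.sub (tendsto_const_nhds (x := eLpNorm f 2 μ)) h (Or.inl h0)
  · simpa using tendsto_const_nhds (x := eLpNorm f 2 μ).add h

theorem integrable_inner_of_memLp {E : Type*} [NormedAddCommGroup E] [InnerProductSpace ℝ E]
    {f g : α → E} (hf : MemLp f 2 μ) (hg : MemLp g 2 μ) :
    Integrable (fun a => inner ℝ (f a) (g a)) μ := by
  have h1 : Integrable (fun a => ‖f a‖ ^ 2) μ := hf.integrable_norm_pow (by norm_num)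
  have h2 : Integrable (fun a => ‖g a‖ ^ 2) μ := hg.integrable_norm_pow (by norm_num)
  refine (h1.add h2).mono (hf.1.inner hg.1) (Eventually.of_forall fun a => ?_)
  have := abs_real_inner_le_norm (f a) (g a)
  rw [Real.norm_eq_abs, Real.norm_eq_abs, Pi.add_apply, abs_of_nonneg (a := _ + _) (by positivity)]
  nlinarith [sq_nonneg (‖f a‖ - ‖g a‖), norm_nonneg (f a), norm_nonneg (g a)]

/-- Young's inequality for the `L²` pairing. -/
theorem integral_inner_le_young {E : Type*} [NormedAddCommGroup E] [InnerProductSpace ℝ E]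
    {f g : α → E} (hf : MemLp f 2 μ) (hg : MemLp g 2 μ) {δ : ℝ} (hδ : 0 < δ) :
    ∫ a, inner ℝ (f a) (g a) ∂μ
      ≤ (4 * δ)⁻¹ * ∫ a, ‖f a‖ ^ 2 ∂μ + δ * ∫ a, ‖g a‖ ^ 2 ∂μ := by
  have h1 : Integrable (fun a => ‖f a‖ ^ 2) μ := hf.integrable_norm_pow (by norm_num)
  have h2 : Integrable (fun a => ‖g a‖ ^ 2) μ := hg.integrable_norm_pow (by norm_num)
  rw [← integral_const_mul, ← integral_const_mul, ← integral_add (h1.const_mul _) (h2.const_mul _)]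
  have h3 := integrable_inner_of_memLp hf hg
  refine integral_mono h3 ((h1.const_mul _).add (h2.const_mul _)) fun a => ?_
  have h4 := real_inner_le_norm (f a) (g a)
  have h5 : (4 * δ)⁻¹ * ‖f a‖ ^ 2 + δ * ‖g a‖ ^ 2 - ‖f a‖ * ‖g a‖
      = (4 * δ)⁻¹ * (‖f a‖ - 2 * δ * ‖g a‖) ^ 2 := by
    field_simp
    ring
  have h6 : 0 ≤ (4 * δ)⁻¹ * (‖f a‖ - 2 * δ * ‖g a‖) ^ 2 := by positivity
  linarith

end SquareIntegrable

/-! ### Representation of bounded functionals -/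

/-- A linear functional that is bounded by `‖A v‖` is the inner product of `A v` with a fixed vector
of controlled norm. -/
theorem exists_inner_eq_of_abs_le {V H : Type*} [AddCommGroup V] [Module ℝ V]
    [NormedAddCommGroup H] [InnerProductSpace ℝ H] [CompleteSpace H]
    (A : V →ₗ[ℝ] H) (l : V →ₗ[ℝ] ℝ) {K : ℝ} (hK : 0 ≤ K) (h : ∀ v, |l v| ≤ K * ‖A v‖) :
    ∃ u : H, ‖u‖ ≤ K ∧ ∀ v, inner ℝ u (A v) = l v := by
  -- By the bound, `l` descends to a functional `m` on the range of `A`.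
  have hker : LinearMap.ker A ≤ LinearMap.ker l := by
    intro v hv
    have := h v
    rw [LinearMap.mem_ker.1 hv, norm_zero, mul_zero] at this
    exact abs_eq_zero.1 (le_antisymm this (abs_nonneg _))
  let m : LinearMap.range A →ₗ[ℝ] ℝ :=
    ((LinearMap.ker A).liftQ l hker) ∘ₗ (A.quotKerEquivRange.symm : LinearMap.range A →ₗ[ℝ] _)
  have hm : ∀ v, m ⟨A v, LinearMap.mem_range_self A v⟩ = l v := by
    intro v
    have : A.quotKerEquivRange.symm ⟨A v, LinearMap.mem_range_self A v⟩
        = (LinearMap.ker A).mkQ v := by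
      rw [LinearEquiv.symm_apply_eq]; rfl
    simp [m, this]
  have hmb : ∀ x, ‖m x‖ ≤ K * ‖x‖ := by
    rintro ⟨_, v, rfl⟩
    rw [hm]
    exact h v
  obtain ⟨G, hG, hGn⟩ := exists_extension_norm_eq _ (m.mkContinuous K hmb)
  refine ⟨(InnerProductSpace.toDual ℝ H).symm G, ?_, fun v => ?_⟩
  · rw [LinearIsometryEquiv.norm_map, hGn]
    exact LinearMap.mkContinuous_norm_le _ hK _
  · rw [InnerProductSpace.toDual_symm_apply]
    have := hG ⟨A v, LinearMap.mem_range_self A v⟩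
    rw [this, LinearMap.mkContinuous_apply, hm]

/-! ### A directional Poincaré inequality -/

/-- Poincaré's inequality in the direction `e`: moving in the direction `-e` from a point of `U`,
the open set `U` is left after a time at most `R`, and `F` vanishes at the point of exit. -/
theorem lintegral_sq_le_directional {E W : Type*} [NormedAddCommGroup E] [NormedSpace ℝ E]
    [MeasurableSpace E] [BorelSpace E] [SecondCountableTopology E]
    [NormedAddCommGroup W] [NormedSpace ℝ W] [CompleteSpace W]
    (μ : Measure E) [μ.IsAddRightInvariant] [SFinite μ] {F : E → W} (hF : ContDiff ℝ 1 F)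
    {U : Set E} (hU : IsOpen U) (e : E) {R : ℝ}
    (hexit : ∀ x ∈ U, ∃ s ∈ Set.Icc 0 R, x - s • e ∉ U)
    (hzero : ∀ x ∉ U, (∃ δ > (0 : ℝ), ∀ s ∈ Set.Ioo 0 δ, x + s • e ∈ U) → F x = 0) :
    ∫⁻ x in U, ‖F x‖ₑ ^ 2 ∂μ
      ≤ ENNReal.ofReal R ^ 2 * ∫⁻ x in U, ‖fderiv ℝ F x e‖ₑ ^ 2 ∂μ := by
  set D : E → W := fun x => fderiv ℝ F x e with hD
  have hDc : Continuous D := (hF.continuous_fderiv (by norm_num)).clm_apply continuous_const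
  set g : E → ENNReal := U.indicator fun x => ‖D x‖ₑ with hg
  have hgm : Measurable g := (hDc.enorm.measurable).indicator hU.measurableSet
  have hpt : ∀ x ∈ U, ‖F x‖ₑ ≤ ∫⁻ s in Set.Ioc 0 R, g (x - s • e) := by
    intro x hx
    set S : Set ℝ := {s | 0 ≤ s ∧ x - s • e ∉ U} with hS
    have hcont : Continuous fun s : ℝ => x - s • e := by fun_prop
    have hScl : IsClosed S := isClosed_Ici.inter (hU.isClosed_compl.preimage hcont)
    obtain ⟨s₁, hs₁, hs₁U⟩ := hexit x hx
    have hbdd : BddBelow S := ⟨0, fun s hs => hs.1⟩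
    have hmem : sInf S ∈ S := hScl.csInf_mem ⟨s₁, hs₁.1, hs₁U⟩ hbdd
    -- `t` is the first exit time; `F` vanishes at the exit point `x - t • e`.
    set t := sInf S
    have htR : t ≤ R := (csInf_le hbdd ⟨hs₁.1, hs₁U⟩).trans hs₁.2
    have ht0 : 0 < t := lt_of_le_of_ne hmem.1 fun h0 => hmem.2 (by rw [← h0]; simpa using hx)
    have hin : ∀ s, 0 ≤ s → s < t → x - s • e ∈ U := by
      intro s hs hst
      by_contra hsU
      exact absurd (csInf_le hbdd ⟨hs, hsU⟩) (not_le.2 hst)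
    have hF0 : F (x - t • e) = 0 := by
      refine hzero _ hmem.2 ⟨t, ht0, fun s hs => ?_⟩
      have := hin (t - s) (by linarith [hs.2]) (by linarith [hs.1])
      rwa [show x - t • e + s • e = x - (t - s) • e by module]
    have hder : ∀ s : ℝ, HasDerivAt (fun s : ℝ => F (x - s • e)) (-D (x - s • e)) s := by
      intro s
      have h1 := (hF.differentiable (by norm_num) (x - s • e)).hasFDerivAt
      have h2 : HasDerivAt (fun s : ℝ => x - s • e) (-e) s := by
        simpa using ((hasDerivAt_id s).smul_const e).const_sub x
      simpa [hD, Function.comp_def] using h1.comp_hasDerivAt s h2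
    have hint := intervalIntegral.integral_eq_sub_of_hasDerivAt (a := 0) (b := t)
      (fun s _ => hder s) ((hDc.comp hcont).neg.intervalIntegrable _ _)
    rw [hF0, zero_smul, sub_zero, zero_sub, intervalIntegral.integral_of_le ht0.le] at hint
    calc ‖F x‖ₑ = ‖∫ s in Set.Ioc 0 t, -D (x - s • e)‖ₑ := by rw [hint, enorm_neg]
      _ ≤ ∫⁻ s in Set.Ioc 0 t, ‖-D (x - s • e)‖ₑ := enorm_integral_le_lintegral_enorm _
      _ = ∫⁻ s in Set.Ioo 0 t, ‖-D (x - s • e)‖ₑ := setLIntegral_congr Ioo_ae_eq_Ioc.symm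
      _ = ∫⁻ s in Set.Ioo 0 t, g (x - s • e) := by
        refine setLIntegral_congr_fun measurableSet_Ioo fun s hs => ?_
        simp only [hg]
        rw [Set.indicator_of_mem (hin s hs.1.le hs.2), enorm_neg]
      _ ≤ ∫⁻ s in Set.Ioc 0 R, g (x - s • e) :=
        lintegral_mono_set fun s hs => ⟨hs.1, hs.2.le.trans htR⟩
  have hgm2 : Measurable fun q : E × ℝ => g (q.1 - q.2 • e) := by
    refine hgm.comp ?_
    exact (by fun_prop : Continuous fun q : E × ℝ => q.1 - q.2 • e).measurable
  -- After Tonelli's theorem, each translate by `s • e` contributes the same integral.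
  calc ∫⁻ x in U, ‖F x‖ₑ ^ 2 ∂μ
      ≤ ∫⁻ x in U, (ENNReal.ofReal R * ∫⁻ s in Set.Ioc 0 R, g (x - s • e) ^ 2) ∂μ := by
        refine setLIntegral_mono' hU.measurableSet fun x hx => ?_
        refine (pow_le_pow_left' (hpt x hx) 2).trans ?_
        refine (sq_lintegral_le _ ?_).trans ?_
        · exact (hgm2.comp measurable_prodMk_left).aemeasurable
        · simp
    _ ≤ ∫⁻ x, (ENNReal.ofReal R * ∫⁻ s in Set.Ioc 0 R, g (x - s • e) ^ 2) ∂μ :=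
        setLIntegral_le_lintegral _ _
    _ = ENNReal.ofReal R * ∫⁻ s in Set.Ioc 0 R, ∫⁻ x, g (x - s • e) ^ 2 ∂μ := by
        rw [lintegral_const_mul _ (Measurable.lintegral_prod_right'
          (f := fun q : E × ℝ => g (q.1 - q.2 • e) ^ 2) (hgm2.pow_const 2)),
          lintegral_lintegral_swap]
        exact (hgm2.pow_const 2).aemeasurable
    _ = ENNReal.ofReal R * ∫⁻ s in Set.Ioc 0 R, ∫⁻ x, g x ^ 2 ∂μ := by
        congr 1
        refine lintegral_congr fun s => ?_
        exact lintegral_sub_right_eq_self (fun x => g x ^ 2) (s • e)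
    _ = ENNReal.ofReal R ^ 2 * ∫⁻ x in U, ‖fderiv ℝ F x e‖ₑ ^ 2 ∂μ := by
        rw [← lintegral_indicator hU.measurableSet]
        simp only [lintegral_const, MeasurableSet.univ, Measure.restrict_apply, Set.univ_inter,
          Real.volume_Ioc, sub_zero]
        rw [mul_comm _ (ENNReal.ofReal R), ← mul_assoc, sq]
        congr 1
        refine lintegral_congr fun x => ?_
        by_cases hx : x ∈ U <;> simp [hg, hx, hD]

variable {d : ℕ}

/-! ### Coordinates of the ambient space -/

@[simp] theorem hor_mkPt (y : Vec d) (t : ℝ) : hor (mkPt y t) = y := by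
  ext j; simp [hor, mkPt]

@[simp] theorem mkPt_last (y : Vec d) (t : ℝ) : mkPt y t (Fin.last d) = t := by
  simp [mkPt]

/-- The linear identification of `ℝ^(N-1) × ℝ` with `ℝ^N`. -/
noncomputable def mkPtL (d : ℕ) : (Vec d × ℝ) →L[ℝ] Vec (d + 1) :=
  LinearMap.toContinuousLinearMap
    { toFun := fun q => mkPt q.1 q.2
      map_add' := fun p q => by
        ext j
        refine Fin.lastCases ?_ (fun i => ?_) j <;> simp [mkPt]
      map_smul' := fun c q => by
        ext j
        refine Fin.lastCases ?_ (fun i => ?_) j <;> simp [mkPt] }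

theorem mkPtL_apply (q : Vec d × ℝ) : mkPtL d q = mkPt q.1 q.2 := rfl

theorem continuous_hor : Continuous (hor : Vec (d + 1) → Vec d) := by
  unfold hor; fun_prop

/-- The unit vector `e_N` in the vertical direction. -/
noncomputable abbrev eVert (d : ℕ) : Vec (d + 1) := EuclideanSpace.single (Fin.last d) 1

theorem mkPt_add_smul (y : Vec d) (t s : ℝ) : mkPt y (t + s) = mkPt y t + s • eVert d := by
  ext j
  refine Fin.lastCases ?_ (fun i => ?_) j <;> simp [mkPt]

theorem hor_add_smul (x : Vec (d + 1)) (s : ℝ) : hor (x + s • eVert d) = hor x := by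
  ext j; simp [hor]

theorem mkPt_single (j : Fin d) (r : ℝ) :
    mkPt (EuclideanSpace.single j 1) r
      = EuclideanSpace.single j.castSucc (1 : ℝ) + r • eVert d := by
  ext i
  refine Fin.lastCases ?_ (fun i => ?_) i
  · simp [mkPt]
  · simp [mkPt]

theorem measurePreserving_mkPt :
    MeasurePreserving (fun q : Vec d × ℝ => mkPt q.1 q.2) (volume.prod volume) volume := by
  have h1 : MeasurePreserving (Prod.map id (WithLp.ofLp : Vec d → Fin d → ℝ))
      ((volume : Measure ℝ).prod volume) (volume.prod volume) :=
    (MeasurePreserving.id _).prod (PiLp.volume_preserving_ofLp (Fin d))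
  have h2 := (volume_preserving_piFinSuccAbove (fun _ : Fin (d + 1) => ℝ) (Fin.last d)).symm
  have h3 := (PiLp.volume_preserving_toLp (Fin (d + 1))).comp
    (h2.comp (h1.comp (Measure.measurePreserving_swap (μ := (volume : Measure (Vec d)))
      (ν := (volume : Measure ℝ)))))
  have h4 : (fun q : Vec d × ℝ => mkPt q.1 q.2) = WithLp.toLp 2 ∘
      (MeasurableEquiv.piFinSuccAbove (fun _ : Fin (d + 1) => ℝ) (Fin.last d)).symm ∘
      Prod.map id WithLp.ofLp ∘ Prod.swap := by
    funext q
    ext j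
    refine Fin.lastCases ?_ (fun i => ?_) j <;> simp [mkPt, MeasurableEquiv.piFinSuccAbove]
  rw [h4]
  exact h3

theorem lintegral_eq_lintegral_mkPt {h : Vec (d + 1) → ENNReal} (hh : Measurable h) :
    ∫⁻ x, h x = ∫⁻ y : Vec d, ∫⁻ t : ℝ, h (mkPt y t) := by
  rw [← measurePreserving_mkPt.lintegral_comp hh]
  exact lintegral_prod _ (hh.comp measurePreserving_mkPt.measurable).aemeasurable

/-- A bounded set is left, along any unit direction, after a time that depends on its diameter. -/
theorem exists_exit_of_isBounded {E : Type*} [NormedAddCommGroup E] [NormedSpace ℝ E] {U : Set E}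
    (hU : Bornology.IsBounded U) {e : E} (he : ‖e‖ = 1) :
    ∃ R : ℝ, 0 ≤ R ∧ ∀ x ∈ U, ∃ s ∈ Set.Icc 0 R, x - s • e ∉ U := by
  have hR : (0 : ℝ) ≤ Metric.diam U + 1 := by linarith [Metric.diam_nonneg (s := U)]
  refine ⟨Metric.diam U + 1, hR, fun x hx => ⟨_, ⟨hR, le_rfl⟩, fun h => ?_⟩⟩
  have := Metric.dist_le_diam_of_mem hU hx h
  rw [dist_eq_norm, sub_sub_cancel, norm_smul, he, mul_one, Real.norm_of_nonneg hR] at this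
  linarith

namespace Geometry

/-! ### The channel over the interface -/

variable (g : Geometry d)

theorem G_subset : g.G ⊆ g.G₀ := subset_closure.trans g.closure_G_subset

theorem continuousOn_ζ : ContinuousOn g.ζ g.G := g.contDiffOn_ζ.continuousOn.mono g.G_subset

theorem isOpen_Ω₂ : IsOpen g.Ω₂ := by
  have h1 : IsOpen {x : Vec (d + 1) | hor x ∈ g.G} := g.isOpen_G.preimage continuous_hor
  have h2 : ContinuousOn (fun x : Vec (d + 1) => x (Fin.last d) - g.ζ (hor x))
      {x : Vec (d + 1) | hor x ∈ g.G} :=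
    (by fun_prop : Continuous fun x : Vec (d + 1) => x (Fin.last d)).continuousOn.sub
      (g.continuousOn_ζ.comp continuous_hor.continuousOn fun x hx => hx)
  convert h2.isOpen_inter_preimage h1 (isOpen_Ioo (a := (0 : ℝ)) (b := 1)) using 1
  ext x
  simp only [Ω₂, channel, Set.mem_ofPred_eq, Set.mem_inter_iff, Set.mem_preimage, Set.mem_Ioo]
  constructor
  · rintro ⟨h1, h2, h3⟩; exact ⟨h1, by linarith, by linarith⟩
  · rintro ⟨h1, h2, h3⟩; exact ⟨h1, by linarith, by linarith⟩

/-- `∇ζ` is bounded on `G`, being continuous on the compact set `closure G ⊆ G₀`. -/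
theorem exists_gradient_bound : ∃ B : ℝ, 0 ≤ B ∧ ∀ y ∈ g.G, ‖gradient g.ζ y‖ ≤ B := by
  have h1 : ContinuousOn (fun y => ‖gradient g.ζ y‖) g.G₀ := by
    have := g.contDiffOn_ζ.continuousOn_fderiv_of_isOpen g.isOpen_G₀ (by norm_num)
    simp only [gradient, LinearIsometryEquiv.norm_map]
    exact this.norm
  obtain ⟨B, hB⟩ := (Metric.isCompact_of_isClosed_isBounded isClosed_closure
    g.isBounded_G.closure).bddAbove_image (h1.mono g.closure_G_subset)
  exact ⟨max B 0, le_max_right _ _, fun y hy =>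
    (hB ⟨y, subset_closure hy, rfl⟩).trans (le_max_left _ _)⟩

theorem measurable_gradient_ζ : Measurable (gradient g.ζ) := by
  unfold gradient
  exact (LinearIsometryEquiv.continuous _).measurable.comp (measurable_fderiv ℝ g.ζ)

theorem hasFDerivAt_ζ {y : Vec d} (hy : y ∈ g.G) : HasFDerivAt g.ζ (fderiv ℝ g.ζ y) y :=
  ((g.contDiffOn_ζ.differentiableOn (by norm_num)).differentiableAt
    (g.isOpen_G₀.mem_nhds (g.G_subset hy))).hasFDerivAt

theorem fderiv_ζ_single (y : Vec d) (j : Fin d) :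
    fderiv ℝ g.ζ y (EuclideanSpace.single j 1) = gradient g.ζ y j := by
  have : inner ℝ (gradient g.ζ y) (EuclideanSpace.single j (1 : ℝ))
      = fderiv ℝ g.ζ y (EuclideanSpace.single j 1) := by
    simp [gradient]
  rw [← this, EuclideanSpace.inner_single_right]
  simp

theorem norm_normal (y : Vec d) : ‖g.normal y‖ = 1 := by
  have h1 : ‖mkPt (-gradient g.ζ y) (1 : ℝ)‖ = Real.sqrt (1 + ‖gradient g.ζ y‖ ^ 2) := by
    rw [EuclideanSpace.norm_eq, Fin.sum_univ_castSucc, EuclideanSpace.norm_sq_eq]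
    simp [mkPt, add_comm]
  rw [normal, norm_smul, h1, norm_inv, Real.norm_of_nonneg (Real.sqrt_nonneg _)]
  exact inv_mul_cancel₀ (Real.sqrt_pos.2 (by positivity)).ne'

/-- Integration over the channel in the flattened coordinates `(y, t) ↦ (y, ζ y + t)`, which have
Jacobian one. -/
theorem lintegral_Ω₂ {h : Vec (d + 1) → ENNReal} (hh : Measurable h) :
    ∫⁻ x in g.Ω₂, h x = ∫⁻ y in g.G, ∫⁻ t in Set.Ioo (0 : ℝ) 1, h (mkPt y (g.ζ y + t)) := by
  rw [← lintegral_indicator g.isOpen_Ω₂.measurableSet,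
    lintegral_eq_lintegral_mkPt (hh.indicator g.isOpen_Ω₂.measurableSet),
    ← lintegral_indicator g.isOpen_G.measurableSet]
  refine lintegral_congr fun y => ?_
  by_cases hy : y ∈ g.G
  · rw [Set.indicator_of_mem hy, ← lintegral_indicator measurableSet_Ioo,
      ← lintegral_add_left_eq_self (fun t => g.Ω₂.indicator h (mkPt y t)) (g.ζ y)]
    refine lintegral_congr fun t => ?_
    have : mkPt y (g.ζ y + t) ∈ g.Ω₂ ↔ t ∈ Set.Ioo (0 : ℝ) 1 := by
      simp [Ω₂, channel, hy]
    by_cases ht : t ∈ Set.Ioo (0 : ℝ) 1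
    · rw [Set.indicator_of_mem ht, Set.indicator_of_mem (this.2 ht)]
    · rw [Set.indicator_of_notMem ht, Set.indicator_of_notMem (mt this.1 ht)]
  · rw [Set.indicator_of_notMem hy]
    refine (lintegral_congr fun t => ?_).trans lintegral_zero
    refine Set.indicator_of_notMem (fun hx => hy ?_) _
    simpa using hx.1

/-- Integration over the channel slice by slice, the slices being the translates of `Γ`. -/
theorem lintegral_Ω₂_swap {h : Vec (d + 1) → ENNReal} (hh : Measurable h) :
    ∫⁻ x in g.Ω₂, h x = ∫⁻ t in Set.Ioo (0 : ℝ) 1, ∫⁻ y in g.G, h (mkPt y (g.ζ y + t)) := by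
  rw [g.lintegral_Ω₂ hh, lintegral_lintegral_swap]
  have h1 : AEMeasurable g.ζ (volume.restrict g.G) :=
    g.continuousOn_ζ.aemeasurable g.isOpen_G.measurableSet
  have h2 : AEMeasurable (fun q : Vec d × ℝ => g.ζ q.1)
      ((volume.restrict g.G).prod (volume.restrict (Set.Ioo (0 : ℝ) 1))) :=
    h1.comp_quasiMeasurePreserving Measure.quasiMeasurePreserving_fst
  exact hh.comp_aemeasurable ((mkPtL d).continuous.measurable.comp_aemeasurable
    (measurable_fst.aemeasurable.prodMk (h2.add measurable_snd.aemeasurable)))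

theorem exists_surfaceMeasure_le : ∃ M : ℝ, 0 ≤ M ∧
    g.surfaceMeasure ≤ ENNReal.ofReal M • volume.restrict g.G := by
  obtain ⟨B, hB0, hB⟩ := g.exists_gradient_bound
  refine ⟨Real.sqrt (1 + B ^ 2), Real.sqrt_nonneg _, ?_⟩
  rw [← withDensity_const]
  refine withDensity_mono ?_
  filter_upwards [ae_restrict_mem g.isOpen_G.measurableSet] with y hy
  have := hB y hy
  gcongr

theorem surfaceMeasure_absolutelyContinuous : g.surfaceMeasure ≪ volume.restrict g.G :=
  withDensity_absolutelyContinuous _ _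

end Geometry

theorem _root_.ENNReal.add_sq_le_two_mul (a b : ENNReal) :
    (a + b) ^ 2 ≤ 2 * (a ^ 2 + b ^ 2) := by
  have h := ENNReal.rpow_add_le_mul_rpow_add_rpow a b (p := 2) (by norm_num)
  norm_num at h
  exact_mod_cast h

namespace Geometry

variable (g : Geometry d)

/-! ### Inequalities on the channel for smooth fields -/

/-- The field `y ↦ φ (y, ζ y + t)` on the slice of the channel at height `t`, extended by zero. -/
noncomputable def slice (φ : Vec (d + 1) → Vec (d + 1)) (t : ℝ) : Vec d → Vec (d + 1) :=
  g.G.indicator fun y => φ (mkPt y (g.ζ y + t))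

variable {φ : Vec (d + 1) → Vec (d + 1)}

/-- The zero extension is smooth across `∂G`, since the support of `φ` projects to a compact subset
of `G`. -/
theorem contDiff_slice (hφ : ContDiff ℝ 1 φ) (hc : HasCompactSupport φ)
    (hs : tsupport φ ⊆ {x | hor x ∈ g.G}) (t : ℝ) : ContDiff ℝ 1 (g.slice φ t) := by
  rw [contDiff_iff_contDiffAt]
  intro y
  by_cases hy : y ∈ g.G
  · have h1 : ContDiffAt ℝ 1 g.ζ y :=
      (g.contDiffOn_ζ.contDiffAt (g.isOpen_G₀.mem_nhds (g.G_subset hy))).of_le (by norm_num)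
    have h2 : ContDiffAt ℝ 1 (fun y => φ (mkPtL d (y, g.ζ y + t))) y :=
      hφ.contDiffAt.comp y ((mkPtL d).contDiff.contDiffAt.comp y
        (contDiffAt_id.prodMk (h1.add contDiffAt_const)))
    refine h2.congr_of_eventuallyEq ?_
    filter_upwards [g.isOpen_G.mem_nhds hy] with z hz
    simp [slice, hz, mkPtL_apply]
  · have h1 : IsClosed (hor '' tsupport φ) := (hc.isCompact.image continuous_hor).isClosed
    have h2 : y ∉ hor '' tsupport φ := by
      rintro ⟨x, hx, rfl⟩
      exact hy (hs hx)
    refine (contDiffAt_const (c := (0 : Vec (d + 1)))).congr_of_eventuallyEq ?_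
    filter_upwards [h1.isOpen_compl.mem_nhds h2] with z hz
    by_cases hzG : z ∈ g.G
    · rw [slice, Set.indicator_of_mem hzG]
      exact image_eq_zero_of_notMem_tsupport fun hx => hz ⟨_, hx, hor_mkPt _ _⟩
    · simp [slice, hzG]

/-- The derivatives along a slice are those of `φ` in the tangential direction `e_j + ∂_j ζ e_N`. -/
theorem fderiv_slice (hφ : ContDiff ℝ 1 φ) (t : ℝ) {y : Vec d} (hy : y ∈ g.G) (j : Fin d) :
    fderiv ℝ (g.slice φ t) y (EuclideanSpace.single j 1)
      = fderiv ℝ φ (mkPt y (g.ζ y + t)) (EuclideanSpace.single j.castSucc 1)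
        + gradient g.ζ y j • fderiv ℝ φ (mkPt y (g.ζ y + t)) (eVert d) := by
  have h1 : HasFDerivAt (fun y => (y, g.ζ y + t))
      ((ContinuousLinearMap.id ℝ (Vec d)).prod (fderiv ℝ g.ζ y)) y :=
    (hasFDerivAt_id y).prodMk ((g.hasFDerivAt_ζ hy).add_const t)
  have h2 := ((hφ.differentiable (by norm_num) (mkPtL d (y, g.ζ y + t))).hasFDerivAt).comp y
    ((mkPtL d).hasFDerivAt.comp y h1)
  have h3 : g.slice φ t =ᶠ[𝓝 y] (φ ∘ mkPtL d ∘ fun y => (y, g.ζ y + t)) := by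
    filter_upwards [g.isOpen_G.mem_nhds hy] with z hz
    simp [slice, hz, mkPtL_apply]
  rw [h3.fderiv_eq, h2.fderiv]
  simp only [ContinuousLinearMap.comp_apply, ContinuousLinearMap.prod_apply,
    ContinuousLinearMap.id_apply, mkPtL_apply, mkPt_single, fderiv_ζ_single, map_add, map_smul]

/-- Poincaré's inequality on the channel, along the directions `e_j + ∂_j ζ e_N` that are tangent to
the slices: these directions see neither the bottom nor the top of the channel. -/
theorem exists_lintegral_sq_le_tangential (j : Fin d) : ∃ R : ℝ, 0 ≤ R ∧
    ∀ φ : Vec (d + 1) → Vec (d + 1), ContDiff ℝ 1 φ → HasCompactSupport φ →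
      tsupport φ ⊆ {x | hor x ∈ g.G} →
      ∫⁻ x in g.Ω₂, ‖φ x‖ₑ ^ 2 ≤ ENNReal.ofReal R ^ 2 * ∫⁻ x in g.Ω₂,
        ‖fderiv ℝ φ x (EuclideanSpace.single j.castSucc 1)
          + gradient g.ζ (hor x) j • fderiv ℝ φ x (eVert d)‖ₑ ^ 2 := by
  obtain ⟨R, hR, hexit⟩ := exists_exit_of_isBounded g.isBounded_G
    (e := (EuclideanSpace.single j (1 : ℝ) : Vec d)) (by simp)
  refine ⟨R, hR, fun φ hφ hc hs => ?_⟩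
  have hm1 : Measurable fun x => ‖φ x‖ₑ ^ 2 := hφ.continuous.enorm.measurable.pow_const 2
  have hfd := hφ.continuous_fderiv (by norm_num)
  have hm2 : Measurable fun x => ‖fderiv ℝ φ x (EuclideanSpace.single j.castSucc 1)
          + gradient g.ζ (hor x) j • fderiv ℝ φ x (eVert d)‖ₑ ^ 2 := by
    have h1 : Measurable fun x => gradient g.ζ (hor x) j :=
      (by fun_prop : Continuous fun v : Vec d => v j).measurable.comp
        (g.measurable_gradient_ζ.comp continuous_hor.measurable)
    exact ((hfd.clm_apply continuous_const).measurable.add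
      (h1.smul (hfd.clm_apply continuous_const).measurable)).enorm.pow_const 2
  rw [g.lintegral_Ω₂_swap hm1, g.lintegral_Ω₂_swap hm2,
    ← lintegral_const_mul' _ _ (ENNReal.pow_ne_top ENNReal.ofReal_ne_top)]
  refine lintegral_mono fun t => ?_
  have h := lintegral_sq_le_directional volume (g.contDiff_slice hφ hc hs t) g.isOpen_G
    (EuclideanSpace.single j (1 : ℝ)) hexit fun x hx _ => by simp [slice, hx]
  convert h using 1
  · refine setLIntegral_congr_fun g.isOpen_G.measurableSet fun y hy => ?_
    simp [slice, hy]
  · congr 1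
    refine setLIntegral_congr_fun g.isOpen_G.measurableSet fun y hy => ?_
    simp only [g.fderiv_slice hφ t hy j, hor_mkPt]

theorem enorm_sub_sq_le_vertical (hφ : ContDiff ℝ 1 φ) (y : Vec d) (s : ℝ) {t : ℝ}
    (ht0 : 0 ≤ t) (ht1 : t ≤ 1) :
    ‖φ (mkPt y (s + t)) - φ (mkPt y s)‖ₑ ^ 2
      ≤ ∫⁻ r in Set.Ioo (0 : ℝ) 1, ‖fderiv ℝ φ (mkPt y (s + r)) (eVert d)‖ₑ ^ 2 := by
  have hcont : Continuous fun r : ℝ => mkPt y (s + r) := by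
    simp only [mkPt_add_smul]; fun_prop
  have hDc : Continuous fun r : ℝ => fderiv ℝ φ (mkPt y (s + r)) (eVert d) :=
    ((hφ.continuous_fderiv (by norm_num)).clm_apply continuous_const).comp hcont
  have hder : ∀ r : ℝ, HasDerivAt (fun r : ℝ => φ (mkPt y (s + r)))
      (fderiv ℝ φ (mkPt y (s + r)) (eVert d)) r := by
    intro r
    have h1 := (hφ.differentiable (by norm_num) (mkPt y (s + r))).hasFDerivAt
    have h2 : HasDerivAt (fun r : ℝ => mkPt y (s + r)) (eVert d) r := by
      simp only [mkPt_add_smul]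
      simpa using ((hasDerivAt_id r).smul_const (eVert d)).const_add (mkPt y s)
    exact h1.comp_hasDerivAt r h2
  have hint := intervalIntegral.integral_eq_sub_of_hasDerivAt (a := 0) (b := t)
    (fun s _ => hder s) (hDc.intervalIntegrable _ _)
  rw [add_zero, intervalIntegral.integral_of_le ht0] at hint
  have h1 : ‖φ (mkPt y (s + t)) - φ (mkPt y s)‖ₑ
      ≤ ∫⁻ r in Set.Ioo (0 : ℝ) 1, ‖fderiv ℝ φ (mkPt y (s + r)) (eVert d)‖ₑ := by
    rw [← hint]
    refine (enorm_integral_le_lintegral_enorm _).trans ?_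
    rw [← setLIntegral_congr Ioo_ae_eq_Ioc]
    exact lintegral_mono_set fun r hr => ⟨hr.1, hr.2.trans_le ht1⟩
  refine (pow_le_pow_left' h1 2).trans
    ((sq_lintegral_le _ hDc.enorm.measurable.aemeasurable).trans ?_)
  simp

theorem lintegral_sq_bottom_sub_top_le (hφ : ContDiff ℝ 1 φ) :
    ∫⁻ y in g.G, ‖φ (mkPt y (g.ζ y)) - φ (mkPt y (g.ζ y + 1))‖ₑ ^ 2
      ≤ ∫⁻ x in g.Ω₂, ‖fderiv ℝ φ x (eVert d)‖ₑ ^ 2 := by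
  have hfd := hφ.continuous_fderiv (by norm_num)
  rw [g.lintegral_Ω₂ ((hfd.clm_apply continuous_const).enorm.measurable.pow_const 2)]
  refine lintegral_mono fun y => ?_
  rw [← enorm_neg, neg_sub]
  exact enorm_sub_sq_le_vertical hφ y _ zero_le_one le_rfl

/-- The trace inequality on the bottom of the channel, from averaging over the slices. -/
theorem lintegral_sq_bottom_le (hφ : ContDiff ℝ 1 φ) :
    ∫⁻ y in g.G, ‖φ (mkPt y (g.ζ y))‖ₑ ^ 2
      ≤ 2 * (∫⁻ x in g.Ω₂, ‖φ x‖ₑ ^ 2)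
        + 2 * ∫⁻ x in g.Ω₂, ‖fderiv ℝ φ x (eVert d)‖ₑ ^ 2 := by
  have hfd := hφ.continuous_fderiv (by norm_num)
  have hm1 : Measurable fun x => ‖φ x‖ₑ ^ 2 := hφ.continuous.enorm.measurable.pow_const 2
  have hm2 : Measurable fun x => ‖fderiv ℝ φ x (eVert d)‖ₑ ^ 2 :=
    (hfd.clm_apply continuous_const).enorm.measurable.pow_const 2
  rw [← mul_add, ← lintegral_add_left hm1,
    g.lintegral_Ω₂ (h := fun x => ‖φ x‖ₑ ^ 2 + ‖fderiv ℝ φ x (eVert d)‖ₑ ^ 2) (hm1.add hm2),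
    ← lintegral_const_mul' _ _ (by norm_num)]
  refine lintegral_mono fun y => ?_
  have hcont : Continuous fun r : ℝ => mkPt y (g.ζ y + r) := by
    simp only [mkPt_add_smul]; fun_prop
  rw [lintegral_add_left (f := fun t => ‖φ (mkPt y (g.ζ y + t))‖ₑ ^ 2) (hm1.comp hcont.measurable)]
  set I := ∫⁻ r in Set.Ioo (0 : ℝ) 1, ‖fderiv ℝ φ (mkPt y (g.ζ y + r)) (eVert d)‖ₑ ^ 2
  have h1 : ∀ t ∈ Set.Ioo (0 : ℝ) 1, ‖φ (mkPt y (g.ζ y))‖ₑ ^ 2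
      ≤ 2 * ‖φ (mkPt y (g.ζ y + t))‖ₑ ^ 2 + 2 * I := by
    intro t ht
    have h2 := enorm_sub_sq_le_vertical hφ y (g.ζ y) ht.1.le ht.2.le
    have h3 : ‖φ (mkPt y (g.ζ y))‖ₑ ≤ ‖φ (mkPt y (g.ζ y + t))‖ₑ
        + ‖φ (mkPt y (g.ζ y + t)) - φ (mkPt y (g.ζ y))‖ₑ := by
      have := enorm_sub_le (a := φ (mkPt y (g.ζ y + t)))
        (b := φ (mkPt y (g.ζ y + t)) - φ (mkPt y (g.ζ y)))
      rwa [sub_sub_cancel] at this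
    refine (pow_le_pow_left' h3 2).trans ((ENNReal.add_sq_le_two_mul _ _).trans ?_)
    rw [mul_add]
    gcongr
  have h4 := setLIntegral_mono' (μ := volume) measurableSet_Ioo h1
  rw [lintegral_add_right _ measurable_const, lintegral_const_mul' _ _ (by norm_num)] at h4
  simpa [mul_add] using h4

end Geometry

/-! ### Inequalities on the channel for `H¹` fields -/

/-- The partial derivative `∂_j w`, that is, the `j`-th column of the gradient matrix. -/
noncomputable def gradCol {n : ℕ} (A : Matrix (Fin n) (Fin n) ℝ) (j : Fin n) : Vec n :=
  WithLp.toLp 2 fun i => A i j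

@[simp] theorem gradCol_apply {n : ℕ} (A : Matrix (Fin n) (Fin n) ℝ) (j i : Fin n) :
    gradCol A j i = A i j := rfl

theorem eLpNorm_le_sum_components {α : Type*} [MeasurableSpace α] {μ : Measure α} {n : ℕ}
    {f : α → Vec n} (hf : ∀ i, AEStronglyMeasurable (fun x => f x i) μ) :
    eLpNorm f 2 μ ≤ ∑ i, eLpNorm (fun x => f x i) 2 μ := by
  have h1 : eLpNorm f 2 μ ≤ eLpNorm (∑ i, fun x => |f x i|) 2 μ := by
    refine eLpNorm_mono_real fun x => ?_
    have : f x = ∑ i, EuclideanSpace.single i (f x i) := by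
      ext k; simp [Finset.sum_apply, Pi.single_apply]
    rw [Finset.sum_apply]
    conv_lhs => rw [this]
    exact (norm_sum_le _ _).trans (by simp)
  refine h1.trans ((eLpNorm_sum_le (fun i _ => (hf i).norm) (by norm_num)).trans ?_)
  exact Finset.sum_le_sum fun i _ => (eLpNorm_norm _).le

theorem memLp_of_components {α : Type*} [MeasurableSpace α] {μ : Measure α} {n : ℕ}
    {f : α → Vec n} (hf : ∀ i, MemLp (fun x => f x i) 2 μ) : MemLp f 2 μ := by
  refine ⟨?_, (eLpNorm_le_sum_components fun i => (hf i).1).trans_lt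
    (ENNReal.sum_lt_top.2 fun i _ => (hf i).2)⟩
  have h : AEMeasurable (fun x i => f x i) μ :=
    aemeasurable_pi_lambda _ fun i => (hf i).1.aemeasurable
  exact ((by fun_prop : Continuous fun v : Fin n → ℝ =>
    (WithLp.toLp 2 v : Vec n)).measurable.comp_aemeasurable h).aestronglyMeasurable

namespace Geometry

variable {g : Geometry d} {w : Vec (d + 1) → Vec (d + 1)}
  {Dw : Vec (d + 1) → Matrix (Fin (d + 1)) (Fin (d + 1)) ℝ} {γ₀ γ₁ : Vec d → Vec (d + 1)}

theorem IsLateralH1.memLp_gradCol (h : g.IsLateralH1 w Dw γ₀ γ₁) (j : Fin (d + 1)) :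
    MemLp (fun x => gradCol (Dw x) j) 2 (volume.restrict g.Ω₂) :=
  memLp_of_components fun i => h.2.1 i j

theorem memLp_gradient_smul {W : Type*} [NormedAddCommGroup W] [NormedSpace ℝ W]
    {f : Vec (d + 1) → W} (hf : MemLp f 2 (volume.restrict g.Ω₂)) (j : Fin d) :
    MemLp (fun x => gradient g.ζ (hor x) j • f x) 2 (volume.restrict g.Ω₂) := by
  obtain ⟨B, hB0, hB⟩ := g.exists_gradient_bound
  have h1 : Measurable fun x : Vec (d + 1) => gradient g.ζ (hor x) j :=
    (by fun_prop : Continuous fun v : Vec d => v j).measurable.comp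
      (g.measurable_gradient_ζ.comp continuous_hor.measurable)
  refine hf.of_le_mul (c := B) (h1.aestronglyMeasurable.smul hf.1) ?_
  filter_upwards [ae_restrict_mem g.isOpen_Ω₂.measurableSet] with x hx
  rw [norm_smul]
  gcongr
  exact (PiLp.norm_apply_le _ j).trans (hB _ hx.1)

theorem eLpNorm_gradient_smul_le (f : Vec (d + 1) → Vec (d + 1)) (j : Fin d) {B : ℝ}
    (hB : ∀ y ∈ g.G, ‖gradient g.ζ y‖ ≤ B) :
    eLpNorm (fun x => gradient g.ζ (hor x) j • f x) 2 (volume.restrict g.Ω₂)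
      ≤ ENNReal.ofReal B * eLpNorm f 2 (volume.restrict g.Ω₂) := by
  refine eLpNorm_le_mul_eLpNorm_of_ae_le_mul ?_ 2
  filter_upwards [ae_restrict_mem g.isOpen_Ω₂.measurableSet] with x hx
  rw [norm_smul]
  gcongr
  exact (PiLp.norm_apply_le _ j).trans (hB _ hx.1)

theorem aestronglyMeasurable_comp_graph {φ : Vec (d + 1) → Vec (d + 1)} (hφ : Continuous φ)
    (t : ℝ) : AEStronglyMeasurable (fun y => φ (mkPt y (g.ζ y + t))) (volume.restrict g.G) := by
  refine ContinuousOn.aestronglyMeasurable ?_ g.isOpen_G.measurableSet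
  exact (hφ.comp (mkPtL d).continuous).comp_continuousOn
    (continuousOn_id.prodMk (g.continuousOn_ζ.add continuousOn_const))

/-- Smooth fields that approximate a field in `H¹`, with all convergences expressed through norms of
vector fields. -/
theorem IsLateralH1.exists_approx (h : g.IsLateralH1 w Dw γ₀ γ₁) :
    ∃ φ : ℕ → Vec (d + 1) → Vec (d + 1),
      (∀ n, ContDiff ℝ 1 (φ n) ∧ HasCompactSupport (φ n) ∧ tsupport (φ n) ⊆ {x | hor x ∈ g.G}) ∧
      Tendsto (fun n => eLpNorm (φ n) 2 (volume.restrict g.Ω₂)) atTop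
        (𝓝 (eLpNorm w 2 (volume.restrict g.Ω₂))) ∧
      (∀ j, Tendsto (fun n => eLpNorm (fun x => fderiv ℝ (φ n) x (EuclideanSpace.single j 1)
        - gradCol (Dw x) j) 2 (volume.restrict g.Ω₂)) atTop (𝓝 0)) ∧
      Tendsto (fun n => eLpNorm (fun y => φ n (mkPt y (g.ζ y))) 2 (volume.restrict g.G)) atTop
        (𝓝 (eLpNorm γ₀ 2 (volume.restrict g.G))) ∧
      Tendsto (fun n => eLpNorm (fun y => φ n (mkPt y (g.ζ y)) - φ n (mkPt y (g.ζ y + 1))) 2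
        (volume.restrict g.G)) atTop
        (𝓝 (eLpNorm (fun y => γ₀ y - γ₁ y) 2 (volume.restrict g.G))) := by
  obtain ⟨hw, hDw, hγ₀, hγ₁, φ, hφ, h1, h2, h3, h4⟩ := h
  have hφ1 : ∀ n, ContDiff ℝ 1 (φ n) := fun n => (hφ n).1.of_le (by exact_mod_cast le_top)
  have hb : ∀ n, AEStronglyMeasurable (fun y => φ n (mkPt y (g.ζ y))) (volume.restrict g.G) := by
    intro n
    simpa using aestronglyMeasurable_comp_graph (g := g) (hφ1 n).continuous 0
  have ht := fun n => aestronglyMeasurable_comp_graph (g := g) (hφ1 n).continuous 1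
  refine ⟨φ, fun n => ⟨hφ1 n, (hφ n).2⟩,
    tendsto_eLpNorm_of_tendsto_sub hw (fun n => (hφ1 n).continuous.aestronglyMeasurable) h1,
    fun j => ?_, tendsto_eLpNorm_of_tendsto_sub hγ₀ hb h3,
    tendsto_eLpNorm_of_tendsto_sub (hγ₀.sub hγ₁) (fun n => (hb n).sub (ht n)) ?_⟩
  · have hs : Tendsto (fun n => ∑ i, eLpNorm (fun x => partialDeriv (φ n) x i j - Dw x i j) 2
        (volume.restrict g.Ω₂)) atTop (𝓝 0) := by
      simpa using tendsto_finsetSum Finset.univ fun i _ => h2 i j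
    refine tendsto_of_tendsto_of_tendsto_of_le_of_le tendsto_const_nhds hs (fun n => zero_le)
      fun n => eLpNorm_le_sum_components fun i => ?_
    have hc : Continuous fun x => fderiv ℝ (φ n) x (EuclideanSpace.single j 1) :=
      ((hφ1 n).continuous_fderiv (by norm_num)).clm_apply continuous_const
    have hc' : Continuous fun x => fderiv ℝ (φ n) x (EuclideanSpace.single j 1) i := by fun_prop
    exact hc'.aestronglyMeasurable.sub (hDw i j).1
  · have hs : Tendsto (fun n => eLpNorm (fun y => φ n (mkPt y (g.ζ y)) - γ₀ y) 2
        (volume.restrict g.G) + eLpNorm (fun y => φ n (mkPt y (g.ζ y + 1)) - γ₁ y) 2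
        (volume.restrict g.G)) atTop (𝓝 0) := by
      simpa using h3.add h4
    refine tendsto_of_tendsto_of_tendsto_of_le_of_le tendsto_const_nhds hs (fun n => zero_le)
      fun n => ?_
    have := eLpNorm_sub_le ((hb n).sub hγ₀.1) ((ht n).sub hγ₁.1) (p := 2) (by norm_num)
    refine le_trans (le_of_eq ?_) this
    congr 1
    funext y
    simp only [Pi.sub_apply]
    abel

/-- Poincaré's inequality along the slices of the channel, for fields in `H¹` that vanish on the
lateral wall. -/
theorem exists_integral_sq_le_tangential (g : Geometry d) (j : Fin d) : ∃ R : ℝ, 0 ≤ R ∧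
    ∀ {w Dw γ₀ γ₁}, g.IsLateralH1 w Dw γ₀ γ₁ →
      ∫ x in g.Ω₂, ‖w x‖ ^ 2 ≤ R ^ 2 * ∫ x in g.Ω₂,
        ‖gradCol (Dw x) j.castSucc + gradient g.ζ (hor x) j • gradCol (Dw x) (Fin.last d)‖ ^ 2 := by
  obtain ⟨R, hR, hP⟩ := g.exists_lintegral_sq_le_tangential j
  obtain ⟨B, hB0, hB⟩ := g.exists_gradient_bound
  refine ⟨R, hR, fun {w Dw γ₀ γ₁} h => ?_⟩
  have hm := (h.memLp_gradCol j.castSucc).add (memLp_gradient_smul (h.memLp_gradCol (Fin.last d)) j)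
  refine integral_norm_sq_le_mul hR h.1 hm ?_
  obtain ⟨φ, hφ, h1, h2, -, -⟩ := h.exists_approx
  have hfd : ∀ n k, Continuous fun x => fderiv ℝ (φ n) x (EuclideanSpace.single k 1) := fun n k =>
    ((hφ n).1.continuous_fderiv (by norm_num)).clm_apply continuous_const
  have hg : Measurable fun x : Vec (d + 1) => gradient g.ζ (hor x) j :=
    (by fun_prop : Continuous fun v : Vec d => v j).measurable.comp
      (g.measurable_gradient_ζ.comp continuous_hor.measurable)
  have h3 := tendsto_eLpNorm_of_tendsto_sub hm
    (φ := fun n x => fderiv ℝ (φ n) x (EuclideanSpace.single j.castSucc 1)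
          + gradient g.ζ (hor x) j • fderiv ℝ (φ n) x (eVert d))
    (fun n => (hfd n _).aestronglyMeasurable.add
      (hg.aestronglyMeasurable.smul (hfd n _).aestronglyMeasurable)) ?_
  · refine le_of_tendsto_of_tendsto' h1
      (ENNReal.Tendsto.const_mul h3 (Or.inr ENNReal.ofReal_ne_top)) fun n => ?_
    refine (ENNReal.pow_le_pow_left_iff two_ne_zero).1 ?_
    rw [mul_pow, eLpNorm_two_sq, eLpNorm_two_sq]
    exact hP _ (hφ n).1 (hφ n).2.1 (hφ n).2.2
  · have hs := (h2 j.castSucc).add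
      (ENNReal.Tendsto.const_mul (h2 (Fin.last d)) (Or.inr (ENNReal.ofReal_ne_top (r := B))))
    rw [mul_zero, add_zero] at hs
    refine tendsto_of_tendsto_of_tendsto_of_le_of_le tendsto_const_nhds hs (fun n => zero_le)
      fun n => ?_
    have h5 := ((hfd n (Fin.last d)).aestronglyMeasurable.sub (h.memLp_gradCol (Fin.last d)).1)
    refine le_trans (le_of_eq ?_) ((eLpNorm_add_le
      ((hfd n j.castSucc).aestronglyMeasurable.sub (h.memLp_gradCol j.castSucc).1)
      (hg.aestronglyMeasurable.smul h5) (p := 2) (by norm_num)).trans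
        (add_le_add le_rfl (eLpNorm_gradient_smul_le _ j hB)))
    congr 1
    funext x
    simp only [Pi.add_apply, Pi.sub_apply, Pi.smul_apply', smul_sub]
    abel

theorem IsLateralH1.tendsto_vertical (h : g.IsLateralH1 w Dw γ₀ γ₁)
    {φ : ℕ → Vec (d + 1) → Vec (d + 1)} (hφ : ∀ n, ContDiff ℝ 1 (φ n))
    (h2 : Tendsto (fun n => eLpNorm (fun x => fderiv ℝ (φ n) x (eVert d)
        - gradCol (Dw x) (Fin.last d)) 2 (volume.restrict g.Ω₂)) atTop (𝓝 0)) :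
    Tendsto (fun n => eLpNorm (fun x => fderiv ℝ (φ n) x (eVert d)) 2 (volume.restrict g.Ω₂)) atTop
      (𝓝 (eLpNorm (fun x => gradCol (Dw x) (Fin.last d)) 2 (volume.restrict g.Ω₂))) :=
  tendsto_eLpNorm_of_tendsto_sub (h.memLp_gradCol _) (fun n =>
    (((hφ n).continuous_fderiv (by norm_num)).clm_apply
      continuous_const).aestronglyMeasurable) h2

/-- The traces on the bottom and on the top of the channel differ by the integral of the vertical
derivative. -/
theorem IsLateralH1.integral_sq_trace_sub_le (h : g.IsLateralH1 w Dw γ₀ γ₁) :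
    ∫ y in g.G, ‖γ₀ y - γ₁ y‖ ^ 2 ≤ ∫ x in g.Ω₂, ‖gradCol (Dw x) (Fin.last d)‖ ^ 2 := by
  obtain ⟨φ, hφ, -, h2, -, h4⟩ := h.exists_approx
  have h3 := h.tendsto_vertical (fun n => (hφ n).1) (h2 (Fin.last d))
  have := integral_norm_sq_le_mul (R := 1) zero_le_one (h.2.2.1.sub h.2.2.2.1)
    (h.memLp_gradCol (Fin.last d)) ?_
  · simpa using this
  · rw [ENNReal.ofReal_one, one_mul]
    refine le_of_tendsto_of_tendsto' h4 h3 fun n => ?_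
    refine (ENNReal.pow_le_pow_left_iff two_ne_zero).1 ?_
    rw [eLpNorm_two_sq, eLpNorm_two_sq]
    exact g.lintegral_sq_bottom_sub_top_le (hφ n).1

theorem IsLateralH1.integral_sq_trace_le (h : g.IsLateralH1 w Dw γ₀ γ₁) :
    ∫ y in g.G, ‖γ₀ y‖ ^ 2 ≤ 2 * (∫ x in g.Ω₂, ‖w x‖ ^ 2)
      + 2 * ∫ x in g.Ω₂, ‖gradCol (Dw x) (Fin.last d)‖ ^ 2 := by
  obtain ⟨φ, hφ, h1, h2, h4, -⟩ := h.exists_approx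
  have h3 := h.tendsto_vertical (fun n => (hφ n).1) (h2 (Fin.last d))
  have hlim : eLpNorm γ₀ 2 (volume.restrict g.G) ^ 2
      ≤ 2 * eLpNorm w 2 (volume.restrict g.Ω₂) ^ 2
        + 2 * eLpNorm (fun x => gradCol (Dw x) (Fin.last d)) 2 (volume.restrict g.Ω₂) ^ 2 := by
    refine le_of_tendsto_of_tendsto' (ENNReal.Tendsto.pow h4)
      ((ENNReal.Tendsto.const_mul (ENNReal.Tendsto.pow h1) (Or.inr (by norm_num))).add
        (ENNReal.Tendsto.const_mul (ENNReal.Tendsto.pow h3) (Or.inr (by norm_num)))) fun n => ?_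
    rw [eLpNorm_two_sq, eLpNorm_two_sq, eLpNorm_two_sq]
    exact g.lintegral_sq_bottom_le (hφ n).1
  have hw := h.1.eLpNorm_ne_top
  have hz := (h.memLp_gradCol (Fin.last d)).eLpNorm_ne_top
  rw [integral_norm_sq_eq_toReal h.2.2.1.1, integral_norm_sq_eq_toReal h.1.1,
    integral_norm_sq_eq_toReal (h.memLp_gradCol (Fin.last d)).1]
  have h5 := ENNReal.toReal_mono (by finiteness) hlim
  rwa [ENNReal.toReal_add (by finiteness) (by finiteness), ENNReal.toReal_mul, ENNReal.toReal_mul,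
    ENNReal.toReal_pow, ENNReal.toReal_pow, ENNReal.toReal_pow, ENNReal.toReal_ofNat] at h5

end Geometry

/-! ### Vertical fields in the porous medium with prescribed divergence -/

/-- The space of test functions `C_c^∞(U)`, as functions on the whole space. -/
def testFunctions {n : ℕ} (U : Set (Vec n)) : Submodule ℝ (Vec n → ℝ) where
  carrier := {φ | ContDiff ℝ ∞ φ ∧ HasCompactSupport φ ∧ tsupport φ ⊆ U}
  add_mem' := fun hφ hψ => ⟨hφ.1.add hψ.1, hφ.2.1.add hψ.2.1,
    (tsupport_add _ _).trans (Set.union_subset hφ.2.2 hψ.2.2)⟩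
  zero_mem' := ⟨contDiff_const, HasCompactSupport.zero, by simp [tsupport]⟩
  smul_mem' := fun c φ hφ => ⟨hφ.1.const_smul c, hφ.2.1.smul_left (f := fun _ => c),
    (tsupport_smul_subset_right (fun _ => c) φ).trans hφ.2.2⟩

theorem memLp_of_mem_testFunctions {n : ℕ} {U : Set (Vec n)} {φ : Vec n → ℝ}
    (hφ : φ ∈ testFunctions U) (μ : Measure (Vec n)) [IsFiniteMeasureOnCompacts μ] :
    MemLp φ 2 μ :=
  hφ.1.continuous.memLp_of_hasCompactSupport hφ.2.1

theorem memLp_fderiv_of_mem_testFunctions {n : ℕ} {U : Set (Vec n)} {φ : Vec n → ℝ}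
    (hφ : φ ∈ testFunctions U) (e : Vec n) (μ : Measure (Vec n)) [IsFiniteMeasureOnCompacts μ] :
    MemLp (fun x => fderiv ℝ φ x e) 2 μ := by
  refine Continuous.memLp_of_hasCompactSupport
    ((hφ.1.continuous_fderiv (by simp)).clm_apply continuous_const) ?_
  exact hφ.2.1.fderiv_apply ℝ e

namespace Geometry

variable (g : Geometry d)

/-- Poincaré's inequality on the porous medium for functions that vanish on `∂Ω` but not on `Γ`.
A downward ray that starts in `Ω₁` cannot leave `Ω₁` through `Γ`, since the points just above `Γ`
belong to the channel; it leaves through `∂Ω`, where the function vanishes. -/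
theorem exists_eLpNorm_le_vertical : ∃ R : ℝ, 0 ≤ R ∧ ∀ φ ∈ testFunctions g.Ω,
    eLpNorm φ 2 (volume.restrict g.Ω₁) ≤ ENNReal.ofReal R *
      eLpNorm (fun x => fderiv ℝ φ x (eVert d)) 2 (volume.restrict g.Ω₁) := by
  obtain ⟨R, hR, hexit⟩ := exists_exit_of_isBounded g.isBounded_Ω₁ (e := eVert d) (by simp)
  refine ⟨R, hR, fun φ hφ => ?_⟩
  refine (ENNReal.pow_le_pow_left_iff two_ne_zero).1 ?_
  rw [mul_pow, eLpNorm_two_sq, eLpNorm_two_sq]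
  refine lintegral_sq_le_directional volume (hφ.1.of_le (by exact_mod_cast le_top)) g.isOpen_Ω₁
    (eVert d) hexit ?_
  rintro x hx ⟨δ, hδ, hδx⟩
  have hlast : ∀ s : ℝ, (x + s • eVert d) (Fin.last d) = x (Fin.last d) + s := by simp
  have hdisj : ∀ s ∈ Set.Ioo 0 δ, x + s • eVert d ∉ g.Ω₂ := fun s hs h =>
    Set.disjoint_left.1 g.disjoint_channel (hδx s hs) h
  -- The point `x` lies neither on `Γ` (`t = 0`) nor in the channel (`t > 0`).
  have hx₂ : ∀ t, hor x ∈ g.G → 0 ≤ t → t < 1 → x (Fin.last d) ≠ g.ζ (hor x) + t := by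
    intro t hxG ht0 ht1 hxt
    have h1 : 0 < min δ (1 - t) := lt_min hδ (by linarith)
    have h2 : min δ (1 - t) / 2 < min δ (1 - t) := by linarith
    refine hdisj (min δ (1 - t) / 2) ⟨by linarith, h2.trans_le (min_le_left _ _)⟩
      ⟨by rwa [hor_add_smul], ?_, ?_⟩
    · rw [hor_add_smul, hlast, hxt]; linarith
    · rw [hor_add_smul, hlast, hxt]
      have := h2.trans_le (min_le_right δ (1 - t))
      linarith
  refine image_eq_zero_of_notMem_tsupport fun hxs => ?_
  rcases hφ.2.2 hxs with (h | ⟨y, hy, rfl⟩) | h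
  · exact hx h
  · exact hx₂ 0 (by simpa using hy) le_rfl zero_lt_one (by simp)
  · exact hx₂ (x (Fin.last d) - g.ζ (hor x)) h.1 (by linarith [h.2.1]) (by linarith [h.2.2])
      (by ring)

/-- For `p ∈ L²(Ω₁)` the field `W e_N` has weak divergence `p` in `Ω₁` and zero normal flux through
`Γ`: the test functions need not vanish on `Γ`. By duality its existence, with a bound, is the
vertical Poincaré inequality. -/
theorem exists_vertical_potential : ∃ R : ℝ, 0 ≤ R ∧ ∀ p : Vec (d + 1) → ℝ,
    MemLp p 2 (volume.restrict g.Ω₁) → ∃ W : Vec (d + 1) → ℝ,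
      MemLp W 2 (volume.restrict g.Ω₁) ∧
      (∫ x in g.Ω₁, ‖W x‖ ^ 2 ≤ R ^ 2 * ∫ x in g.Ω₁, ‖p x‖ ^ 2) ∧
      ∀ φ ∈ testFunctions g.Ω,
        ∫ x in g.Ω₁, W x * fderiv ℝ φ x (eVert d) = -∫ x in g.Ω₁, p x * φ x := by
  obtain ⟨R, hR, hP⟩ := g.exists_eLpNorm_le_vertical
  refine ⟨R, hR, fun p hp => ?_⟩
  set μ := volume.restrict g.Ω₁
  have hφL := fun φ : testFunctions g.Ω => memLp_of_mem_testFunctions φ.2 μ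
  have hdφL := fun φ : testFunctions g.Ω => memLp_fderiv_of_mem_testFunctions φ.2 (eVert d) μ
  have hinner : ∀ {a b : Vec (d + 1) → ℝ} (ha : MemLp a 2 μ) (hb : MemLp b 2 μ),
      inner ℝ (ha.toLp a) (hb.toLp b) = ∫ x, a x * b x ∂μ := by
    intro a b ha hb
    rw [L2.inner_def]
    refine integral_congr_ae ?_
    filter_upwards [ha.coeFn_toLp, hb.coeFn_toLp] with x h1 h2
    rw [h1, h2]
    simp [mul_comm]
  let A : testFunctions g.Ω →ₗ[ℝ] Lp ℝ 2 μ :=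
    { toFun := fun φ => (hdφL φ).toLp _
      map_add' := fun φ ψ => by
        rw [← MemLp.toLp_add]
        refine MemLp.toLp_congr _ _ (Eventually.of_forall fun x => ?_)
        have h1 := φ.2.1.differentiable (by simp) x
        have h2 := ψ.2.1.differentiable (by simp) x
        simp only [Submodule.coe_add, fderiv_add h1 h2, _root_.add_apply,
          Pi.add_apply]
      map_smul' := fun c φ => by
        rw [RingHom.id_apply, ← MemLp.toLp_const_smul]
        refine MemLp.toLp_congr _ _ (Eventually.of_forall fun x => ?_)
        have h1 := φ.2.1.differentiable (by simp) x
        simp only [Submodule.coe_smul, fderiv_const_smul h1, _root_.smul_apply,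
          Pi.smul_apply] }
  let l : testFunctions g.Ω →ₗ[ℝ] ℝ :=
    { toFun := fun φ => -inner ℝ (hp.toLp p) ((hφL φ).toLp _)
      map_add' := fun φ ψ => by
        rw [← neg_add, ← inner_add_right, ← MemLp.toLp_add]
        rfl
      map_smul' := fun c φ => by
        rw [RingHom.id_apply, smul_eq_mul, mul_neg, ← real_inner_smul_right,
          ← MemLp.toLp_const_smul]
        rfl }
  have hl : ∀ φ, |l φ| ≤ (R * ‖hp.toLp p‖) * ‖A φ‖ := by
    intro φ
    change |-inner ℝ (hp.toLp p) ((hφL φ).toLp _)| ≤ _ * ‖(hdφL φ).toLp _‖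
    rw [abs_neg]
    refine (abs_real_inner_le_norm _ _).trans ?_
    rw [mul_comm R, mul_assoc]
    refine mul_le_mul_of_nonneg_left ?_ (norm_nonneg _)
    rw [Lp.norm_toLp, Lp.norm_toLp, ← ENNReal.toReal_ofReal hR, ← ENNReal.toReal_mul]
    exact ENNReal.toReal_mono
      (ENNReal.mul_ne_top ENNReal.ofReal_ne_top (hdφL φ).eLpNorm_ne_top) (hP φ φ.2)
  obtain ⟨u, hu, hul⟩ := exists_inner_eq_of_abs_le A l (by positivity) hl
  refine ⟨u, Lp.memLp u, ?_, fun φ hφ => ?_⟩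
  · rw [integral_norm_sq_eq_toReal (Lp.memLp u).1, integral_norm_sq_eq_toReal hp.1, ← mul_pow]
    rw [Lp.norm_toLp, Lp.norm_def] at hu
    exact pow_le_pow_left₀ ENNReal.toReal_nonneg hu 2
  · have h1 : inner ℝ u ((hdφL ⟨φ, hφ⟩).toLp _)
        = -inner ℝ (hp.toLp p) ((hφL ⟨φ, hφ⟩).toLp _) := hul ⟨φ, hφ⟩
    rw [hinner] at h1
    rw [← h1, ← hinner (Lp.memLp u) (hdφL ⟨φ, hφ⟩), Lp.toLp_coeFn]

theorem Ω₁_subset : g.Ω₁ ⊆ g.Ω := fun _ hx => Or.inl (Or.inl hx)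

theorem Ω₂_subset : g.Ω₂ ⊆ g.Ω := fun _ hx => Or.inr hx

theorem memLp_indicator_Ω₁ {W : Type*} [NormedAddCommGroup W] {f : Vec (d + 1) → W}
    (hf : MemLp f 2 (volume.restrict g.Ω₁)) :
    MemLp (g.Ω₁.indicator f) 2 (volume.restrict g.Ω) := by
  rw [memLp_indicator_iff_restrict g.isOpen_Ω₁.measurableSet,
    Measure.restrict_restrict g.isOpen_Ω₁.measurableSet, Set.inter_eq_left.2 g.Ω₁_subset]
  exact hf

theorem setIntegral_indicator_Ω₁ (f : Vec (d + 1) → ℝ) :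
    ∫ x in g.Ω, g.Ω₁.indicator f x = ∫ x in g.Ω₁, f x := by
  rw [integral_indicator g.isOpen_Ω₁.measurableSet,
    Measure.restrict_restrict g.isOpen_Ω₁.measurableSet, Set.inter_eq_left.2 g.Ω₁_subset]

/-- For every `p ∈ L²(Ω₁)` the velocity space contains a field that vanishes in the channel, has
divergence `p` in the porous medium, and is bounded by `p`. -/
theorem exists_velocity_div_eq : ∃ R : ℝ, 0 ≤ R ∧ ∀ p : Vec (d + 1) → ℝ,
    MemLp p 2 (volume.restrict g.Ω₁) → ∃ w : g.Velocity,
      (∫ x in g.Ω₁, ‖w.val x‖ ^ 2 ≤ R ^ 2 * ∫ x in g.Ω₁, p x ^ 2) ∧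
      (∀ x ∈ g.Ω₁, w.div x = p x) ∧ (∀ x ∈ g.Ω₂, w.val x = 0) ∧ w.grad = 0 ∧ w.trace = 0 := by
  obtain ⟨R, hR, hP⟩ := g.exists_vertical_potential
  refine ⟨R, hR, fun p hp => ?_⟩
  obtain ⟨W, hW, hWp, hWφ⟩ := hP p hp
  have hWv : MemLp (fun x => W x • eVert d) 2 (volume.restrict g.Ω₁) := by
    refine hW.of_le_mul (c := 1) (hW.1.smul_const _) (Eventually.of_forall fun x => ?_)
    simp [norm_smul]
  have hzero : ∀ x ∈ g.Ω₂, g.Ω₁.indicator (fun x => W x • eVert d) x = 0 := fun x hx =>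
    Set.indicator_of_notMem (fun h => Set.disjoint_left.1 g.disjoint_channel h hx) _
  have hval := g.memLp_indicator_Ω₁ hWv
  refine ⟨{ val := g.Ω₁.indicator fun x => W x • eVert d
            div := g.Ω₁.indicator p
            grad := 0
            trace := 0
            topTrace := 0
            memLp_val := hval
            memLp_div := g.memLp_indicator_Ω₁ hp
            isWeakDiv := ?_
            isLateralH1 := ?_
            topTrace_normal := by simp }, ?_, ?_, hzero, rfl, rfl⟩
  · intro φ h1 h2 h3
    have h4 := hWφ φ ⟨h1, h2, h3⟩
    rw [← g.setIntegral_indicator_Ω₁, ← g.setIntegral_indicator_Ω₁] at h4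
    convert h4 using 2
    · funext x
      by_cases hx : x ∈ g.Ω₁
      · rw [Set.indicator_of_mem hx, Set.indicator_of_mem hx, real_inner_smul_left,
          real_inner_comm, gradient, InnerProductSpace.toDual_symm_apply]
      · simp [hx]
    · refine integral_congr_ae (Eventually.of_forall fun x => ?_)
      by_cases hx : x ∈ g.Ω₁ <;> simp [hx]
  · refine ⟨hval.mono_measure (Measure.restrict_mono g.Ω₂_subset le_rfl), fun i j => by simp,
      MemLp.zero, MemLp.zero, fun _ => 0, fun n => ⟨contDiff_const, HasCompactSupport.zero,
        by simp [tsupport]⟩, ?_, fun i j => ?_, by simp, by simp⟩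
    · refine tendsto_const_nhds.congr fun n => ?_
      rw [eq_comm, ← eLpNorm_zero (p := 2) (μ := volume.restrict g.Ω₂) (α := Vec (d + 1))
        (ε := Vec (d + 1))]
      refine eLpNorm_congr_ae ?_
      filter_upwards [ae_restrict_mem g.isOpen_Ω₂.measurableSet] with x hx
      simp [hzero x hx]
    · simp [partialDeriv]
  · refine le_trans (le_of_eq ?_) (hWp.trans (le_of_eq ?_))
    · refine setIntegral_congr_fun g.isOpen_Ω₁.measurableSet fun x hx => ?_
      simp [hx, norm_smul]
    · simp
  · intro x hx
    simp [hx]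

end Geometry

/-! ### Matrices and their square roots -/

section Matrices

variable {n : ℕ}

theorem toEuclideanLin_apply_apply (A : Matrix (Fin n) (Fin n) ℝ) (x : Vec n) (i : Fin n) :
    Matrix.toEuclideanLin A x i = ∑ j, A i j * x j := rfl

theorem norm_toEuclideanLin_le {A : Matrix (Fin n) (Fin n) ℝ} {M : ℝ}
    (hA : ∀ i j, |A i j| ≤ M) (x : Vec n) :
    ‖Matrix.toEuclideanLin A x‖ ≤ (n * (n * M)) * ‖x‖ := by
  have h1 : Matrix.toEuclideanLin A x
      = ∑ i, EuclideanSpace.single i (Matrix.toEuclideanLin A x i) := by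
    ext k; simp [Finset.sum_apply, Pi.single_apply]
  rw [h1]
  refine (norm_sum_le _ _).trans ?_
  have h2 : ∀ i, ‖Matrix.toEuclideanLin A x i‖ ≤ n * (M * ‖x‖) := by
    intro i
    rw [toEuclideanLin_apply_apply]
    refine (norm_sum_le _ _).trans ?_
    have : ∀ j ∈ Finset.univ, ‖A i j * x j‖ ≤ M * ‖x‖ := by
      intro j _
      rw [norm_mul]
      have h3 := PiLp.norm_apply_le x j
      have h4 : ‖A i j‖ ≤ M := hA i j
      have h5 : 0 ≤ M := (norm_nonneg _).trans h4
      gcongr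
    simpa using Finset.sum_le_sum this
  calc _ ≤ ∑ i : Fin n, (n : ℝ) * (M * ‖x‖) := by
        refine Finset.sum_le_sum fun i _ => ?_
        simpa using h2 i
    _ = _ := by simp; ring

theorem aestronglyMeasurable_toEuclideanLin {α : Type*} [MeasurableSpace α] {μ : Measure α}
    {A : α → Matrix (Fin n) (Fin n) ℝ} {v : α → Vec n}
    (hA : ∀ i j, AEMeasurable (fun x => A x i j) μ)
    (hv : AEStronglyMeasurable v μ) :
    AEStronglyMeasurable (fun x => Matrix.toEuclideanLin (A x) (v x)) μ := by
  have h1 : AEMeasurable (fun x i => Matrix.toEuclideanLin (A x) (v x) i) μ := by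
    refine aemeasurable_pi_lambda _ fun i => ?_
    simp only [toEuclideanLin_apply_apply]
    refine Finset.aemeasurable_fun_sum _ fun j _ => (hA i j).mul ?_
    exact (by fun_prop : Continuous fun v : Vec n => v j).measurable.comp_aemeasurable
      hv.aemeasurable
  exact ((by fun_prop : Continuous fun v : Fin n → ℝ =>
    (WithLp.toLp 2 v : Vec n)).measurable.comp_aemeasurable h1).aestronglyMeasurable

theorem isClosed_posSemidef :
    IsClosed {B : Fin n → Fin n → ℝ | (Matrix.of B).PosSemidef} := by
  simp only [Matrix.posSemidef_iff_dotProduct_mulVec, Set.ofPred_and, Set.ofPred_forall]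
  refine IsClosed.inter ?_ (isClosed_iInter fun x => ?_)
  · have : {B : Fin n → Fin n → ℝ | (Matrix.of B).IsHermitian}
        = ⋂ (i) (j), {B : Fin n → Fin n → ℝ | B j i = B i j} := by
      ext B
      simp only [Set.mem_ofPred_eq, Set.mem_iInter, Matrix.IsHermitian.ext_iff, Matrix.of_apply,
        star_trivial]
    rw [this]
    exact isClosed_iInter fun i => isClosed_iInter fun j =>
      isClosed_eq (by fun_prop) (by fun_prop)
  · refine isClosed_le continuous_const ?_
    simp only [dotProduct, Matrix.mulVec, Matrix.of_apply]
    fun_prop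

/-- The square root of positive semidefinite matrices is Borel measurable, being the inverse of the
continuous injective squaring map. -/
theorem exists_measurable_sqrt (n : ℕ) : ∃ S : (Fin n → Fin n → ℝ) → Fin n → Fin n → ℝ,
    Measurable S ∧ ∀ A : Matrix (Fin n) (Fin n) ℝ, 0 ≤ A →
      ∀ i j, CFC.sqrt A i j = S (fun i j => A i j) i j := by
  let P : Set (Fin n → Fin n → ℝ) := {B | (Matrix.of B).PosSemidef}
  have hP : IsClosed P := isClosed_posSemidef
  have : StandardBorelSpace P := hP.measurableSet.standardBorel
  let f : P → Fin n → Fin n → ℝ := fun B i j => ∑ k, B.1 i k * B.1 k j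
  have hf : Measurable f := by
    refine Continuous.measurable ?_
    refine continuous_pi fun i => continuous_pi fun j => ?_
    have h (i j) : Continuous fun B : P => B.1 i j :=
      (by fun_prop : Continuous fun B : Fin n → Fin n → ℝ => B i j).comp continuous_subtype_val
    exact continuous_finsetSum _ fun k _ => (h i k).mul (h k j)
  have hfm : ∀ B : P, Matrix.of (f B) = Matrix.of B.1 * Matrix.of B.1 := by
    intro B; ext i j; rfl
  have hsqrt : ∀ B : P, CFC.sqrt (Matrix.of (f B)) = Matrix.of B.1 := fun B =>
    CFC.sqrt_unique (hfm B).symm (Matrix.nonneg_iff_posSemidef.2 B.2)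
  have hinj : Function.Injective f := by
    intro B C h
    have := (hsqrt B).symm.trans ((congrArg (fun F => CFC.sqrt (Matrix.of F)) h).trans (hsqrt C))
    exact Subtype.ext (Matrix.of.injective this)
  obtain ⟨S, hS, hSf⟩ := (hf.measurableEmbedding hinj).exists_measurable_extend
    (g := (Subtype.val : P → Fin n → Fin n → ℝ)) measurable_subtype_coe fun _ => ⟨0⟩
  refine ⟨S, hS, fun A hA i j => ?_⟩
  let B : P := ⟨fun i j => CFC.sqrt A i j, Matrix.nonneg_iff_posSemidef.1 (CFC.sqrt_nonneg A)⟩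
  have h1 : f B = fun i j => A i j := by
    funext i j
    exact congrFun (congrFun (CFC.sqrt_mul_sqrt_self A hA) i) j
  rw [← h1]
  have h2 : S (f B) = B.1 := congrFun hSf B
  rw [h2]

theorem form_nonneg {A : Matrix (Fin n) (Fin n) ℝ} (hA : 0 ≤ A) (ξ : Vec n) : 0 ≤ form A ξ ξ :=
  (Matrix.isPositive_toEuclideanLin_iff.2 (Matrix.nonneg_iff_posSemidef.1 hA)).2 ξ

theorem nonneg_of_elliptic {A : Matrix (Fin n) (Fin n) ℝ} (hs : A.IsSymm) {c : ℝ} (hc : 0 < c)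
    (hA : ∀ ξ, c * ‖ξ‖ ^ 2 ≤ form A ξ ξ) : 0 ≤ A := by
  rw [Matrix.nonneg_iff_posSemidef, ← Matrix.isPositive_toEuclideanLin_iff]
  refine ⟨Matrix.isSymmetric_toEuclideanLin_iff.2 (by
    rw [Matrix.IsHermitian, Matrix.conjTranspose_eq_transpose_of_trivial]; exact hs), fun ξ => ?_⟩
  exact (by positivity : 0 ≤ c * ‖ξ‖ ^ 2).trans (hA ξ)

theorem sqrt_sqrt_apply {A : Matrix (Fin n) (Fin n) ℝ} (h0 : 0 ≤ A) (η : Vec n) :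
    Matrix.toEuclideanLin (CFC.sqrt A) (Matrix.toEuclideanLin (CFC.sqrt A) η)
      = Matrix.toEuclideanLin A η := by
  conv_rhs => rw [← CFC.sqrt_mul_sqrt_self A h0]
  simp [Matrix.toLpLin_apply]

theorem norm_sqrt_sq {A : Matrix (Fin n) (Fin n) ℝ} (h0 : 0 ≤ A) (η : Vec n) :
    ‖Matrix.toEuclideanLin (CFC.sqrt A) η‖ ^ 2 = form A η η := by
  have hsymm := (Matrix.isPositive_toEuclideanLin_iff.2
    (Matrix.nonneg_iff_posSemidef.1 (CFC.sqrt_nonneg A))).1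
  rw [← real_inner_self_eq_norm_sq, ← hsymm, sqrt_sqrt_apply h0, form]

theorem norm_sqrt_le {A : Matrix (Fin n) (Fin n) ℝ} (h0 : 0 ≤ A) {K : ℝ} (hK : 0 ≤ K)
    (hAK : ∀ ξ, ‖Matrix.toEuclideanLin A ξ‖ ≤ K * ‖ξ‖) (η : Vec n) :
    ‖Matrix.toEuclideanLin (CFC.sqrt A) η‖ ≤ Real.sqrt K * ‖η‖ := by
  refine abs_le_of_sq_le_sq' ?_ (by positivity) |>.2
  rw [norm_sqrt_sq h0, mul_pow, Real.sq_sqrt hK, form]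
  refine (real_inner_le_norm _ _).trans ?_
  have := mul_le_mul_of_nonneg_right (hAK η) (norm_nonneg η)
  linarith [sq ‖η‖]

/-- If `c ≤ A ≤ K` then `√A ≥ c / √K`. -/
theorem le_form_sqrt {A : Matrix (Fin n) (Fin n) ℝ} (h0 : 0 ≤ A) {c K : ℝ} (hK : 0 < K)
    (hA : ∀ ξ, c * ‖ξ‖ ^ 2 ≤ form A ξ ξ) (hAK : ∀ ξ, ‖Matrix.toEuclideanLin A ξ‖ ≤ K * ‖ξ‖)
    (ξ : Vec n) : c / Real.sqrt K * ‖ξ‖ ^ 2 ≤ form (CFC.sqrt A) ξ ξ := by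
  set T := Matrix.toEuclideanLin (CFC.sqrt A) with hT
  have hpos : T.IsPositive :=
    Matrix.isPositive_toEuclideanLin_iff.2 (Matrix.nonneg_iff_posSemidef.1 (CFC.sqrt_nonneg A))
  have hTT := sqrt_sqrt_apply h0
  have hsymm : ∀ x y, inner ℝ (T x) y = inner ℝ x (T y) := hpos.1
  have hn := norm_sqrt_sq h0
  have hTK : ∀ η, ‖T η‖ ≤ Real.sqrt K * ‖η‖ := norm_sqrt_le h0 hK.le hAK
  have hs : 0 < Real.sqrt K := Real.sqrt_pos.2 hK
  -- With `T = √A`, the value `⟨T η, η⟩ ≥ 0` at `η = ξ - t T ξ` and `‖T‖ ≤ √K` give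
  -- `⟨T ξ, ξ⟩ ≥ t ‖T ξ‖ ^ 2 = t ⟨A ξ, ξ⟩`.
  set t := (Real.sqrt K)⁻¹ with ht
  have htK : t * Real.sqrt K = 1 := inv_mul_cancel₀ hs.ne'
  have ht0 : 0 < t := inv_pos.2 hs
  have h1 : 0 ≤ inner ℝ (T (ξ - t • T ξ)) (ξ - t • T ξ) := hpos.2 _
  have h2 : inner ℝ (T (ξ - t • T ξ)) (ξ - t • T ξ)
      = inner ℝ (T ξ) ξ - 2 * t * ‖T ξ‖ ^ 2 + t ^ 2 * inner ℝ (T (T ξ)) (T ξ) := by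
    simp only [map_sub, map_smul, inner_sub_left, inner_sub_right, real_inner_smul_left,
      real_inner_smul_right]
    rw [hsymm (T ξ) ξ, real_inner_self_eq_norm_sq]
    ring
  have h3 : inner ℝ (T (T ξ)) (T ξ) ≤ Real.sqrt K * ‖T ξ‖ ^ 2 := by
    refine (real_inner_le_norm _ _).trans ?_
    have := mul_le_mul_of_nonneg_right (hTK (T ξ)) (norm_nonneg (T ξ))
    linarith [sq ‖T ξ‖]
  have h4 : t ^ 2 * inner ℝ (T (T ξ)) (T ξ) ≤ t * ‖T ξ‖ ^ 2 := by
    calc _ ≤ t ^ 2 * (Real.sqrt K * ‖T ξ‖ ^ 2) := by gcongr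
      _ = t * (t * Real.sqrt K) * ‖T ξ‖ ^ 2 := by ring
      _ = _ := by rw [htK, mul_one]
  have h5 : t * (c * ‖ξ‖ ^ 2) ≤ t * ‖T ξ‖ ^ 2 := by
    rw [hn]; exact mul_le_mul_of_nonneg_left (hA ξ) ht0.le
  rw [div_eq_mul_inv, form, ← hT]
  linarith

end Matrices

namespace Geometry

variable {g : Geometry d} (c : g.Coefficients) (L : g.Localizer)

/-- The form of `√Q` on tangential components is the form of `√Q` on the tangential vectors
that these represent. -/
theorem sqrtTang_form (y : Vec d) (a b : Fin d → ℝ) :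
    ∑ i, (∑ j, c.sqrtTang L y i j * a j) * b i
      = form (CFC.sqrt (c.Q (mkPt y (g.ζ y)))) (∑ j, a j • L.ν j y) (∑ i, b i • L.ν i y) := by
  simp only [form, map_sum, map_smul, sum_inner, inner_sum, real_inner_smul_left,
    real_inner_smul_right, Coefficients.sqrtTang, Finset.sum_mul]
  refine Finset.sum_congr rfl fun j _ => Finset.sum_congr rfl fun i _ => by ring

/-! ### Bounds for elements of the velocity space -/

theorem Velocity.memLp_val_Ω₁ (v : g.Velocity) : MemLp v.val 2 (volume.restrict g.Ω₁) :=
  v.memLp_val.mono_measure (Measure.restrict_mono g.Ω₁_subset le_rfl)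

theorem Velocity.memLp_grad (v : g.Velocity) (i j : Fin (d + 1)) :
    MemLp (fun x => v.grad x i j) 2 (volume.restrict g.Ω₂) := v.isLateralH1.2.1 i j

theorem Velocity.memLp_deps (v : g.Velocity) (ε : ℝ) (i : Fin (d + 1)) (j : Fin d) :
    MemLp (fun x => g.Deps ε (ε • v.grad x) x i j) 2 (volume.restrict g.Ω₂) := by
  have h1 := (v.memLp_grad i j.castSucc).const_mul ε
  have h2 := memLp_gradient_smul (v.memLp_grad i (Fin.last d)) j
  refine (h1.add (h2.const_mul ((1 - 1 / ε) * ε))).ae_eq (Eventually.of_forall fun x => ?_)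
  simp only [Deps, Matrix.smul_apply, smul_eq_mul, Pi.add_apply]
  ring

theorem Velocity.integral_gradCol_last (v : g.Velocity) :
    ∫ x in g.Ω₂, ‖gradCol (v.grad x) (Fin.last d)‖ ^ 2
      = (∫ x in g.Ω₂, ∑ j : Fin d, (v.grad x j.castSucc (Fin.last d)) ^ 2)
        + ∫ x in g.Ω₂, (v.grad x (Fin.last d) (Fin.last d)) ^ 2 := by
  rw [← integral_add (integrable_finsetSum _ fun j _ => (v.memLp_grad _ _).integrable_sq)
    ((v.memLp_grad _ _).integrable_sq)]
  refine integral_congr_ae (Eventually.of_forall fun x => ?_)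
  simp only [EuclideanSpace.norm_sq_eq, gradCol_apply, Fin.sum_univ_castSucc, Real.norm_eq_abs,
    sq_abs]

/-- Since `D^ε(ε v) = ε (∇_T v + ∂_z v ∇_T ζ) - ∂_z v ∇_T ζ`, the tangential derivatives of `ε v`,
and hence `ε v` itself, are controlled uniformly in `ε`. -/
theorem exists_sq_mul_integral_sq_le (hd : 1 ≤ d) (g : Geometry d) : ∃ C : ℝ, 0 ≤ C ∧
    ∀ ε : ℝ, 0 < ε → ∀ v : g.Velocity,
      ε ^ 2 * (∫ x in g.Ω₂, ‖v.val x‖ ^ 2)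
        ≤ C * ((∫ x in g.Ω₂, ∑ i, ∑ j, (g.Deps ε (ε • v.grad x) x i j) ^ 2)
          + ∫ x in g.Ω₂, ‖gradCol (v.grad x) (Fin.last d)‖ ^ 2) := by
  -- Any horizontal direction will do; this is where `N ≥ 2` enters.
  let j₀ : Fin d := ⟨0, hd⟩
  obtain ⟨R, hR, hP⟩ := exists_integral_sq_le_tangential g j₀
  obtain ⟨B, hB0, hB⟩ := g.exists_gradient_bound
  refine ⟨R ^ 2 * (2 + 2 * B ^ 2), by positivity, fun ε hε v => ?_⟩
  have hZ : Integrable (fun x => ‖gradCol (v.grad x) (Fin.last d)‖ ^ 2) (volume.restrict g.Ω₂) :=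
    (v.isLateralH1.memLp_gradCol _).integrable_norm_pow (by norm_num)
  have hD : Integrable (fun x => ∑ i, ∑ j, (g.Deps ε (ε • v.grad x) x i j) ^ 2)
      (volume.restrict g.Ω₂) :=
    integrable_finsetSum _ fun i _ => integrable_finsetSum _ fun j _ =>
      (v.memLp_deps ε i j).integrable_sq
  have hle : ε ^ 2 * (∫ x in g.Ω₂, ‖gradCol (v.grad x) j₀.castSucc
        + gradient g.ζ (hor x) j₀ • gradCol (v.grad x) (Fin.last d)‖ ^ 2)
      ≤ 2 * (∫ x in g.Ω₂, ∑ i, ∑ j, (g.Deps ε (ε • v.grad x) x i j) ^ 2)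
        + 2 * B ^ 2 * ∫ x in g.Ω₂, ‖gradCol (v.grad x) (Fin.last d)‖ ^ 2 := by
    rw [← integral_const_mul, ← integral_const_mul, ← integral_const_mul,
      ← integral_add (hD.const_mul _) (hZ.const_mul _)]
    refine integral_mono_of_nonneg (Eventually.of_forall fun x => by positivity)
      ((hD.const_mul _).add (hZ.const_mul _)) ?_
    filter_upwards [ae_restrict_mem g.isOpen_Ω₂.measurableSet] with x hx
    have hζ : |gradient g.ζ (hor x) j₀| ≤ B := (PiLp.norm_apply_le _ j₀).trans (hB _ hx.1)
    have hζ2 : gradient g.ζ (hor x) j₀ ^ 2 ≤ B ^ 2 := sq_le_sq' (abs_le.1 hζ).1 (abs_le.1 hζ).2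
    simp only [EuclideanSpace.norm_sq_eq, PiLp.add_apply, PiLp.smul_apply, gradCol_apply,
      smul_eq_mul, Real.norm_eq_abs, sq_abs, Finset.mul_sum, ← Finset.sum_add_distrib]
    refine Finset.sum_le_sum fun i _ => ?_
    have h1 : g.Deps ε (ε • v.grad x) x i j₀ ^ 2
        ≤ ∑ j, g.Deps ε (ε • v.grad x) x i j ^ 2 :=
      Finset.single_le_sum (f := fun j => g.Deps ε (ε • v.grad x) x i j ^ 2)
        (fun j _ => sq_nonneg _) (Finset.mem_univ j₀)
    have h2 : ε * (v.grad x i j₀.castSucc + gradient g.ζ (hor x) j₀ * v.grad x i (Fin.last d))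
        = g.Deps ε (ε • v.grad x) x i j₀ + gradient g.ζ (hor x) j₀ * v.grad x i (Fin.last d) := by
      simp only [Deps, Matrix.smul_apply, smul_eq_mul]
      field_simp
      ring
    rw [← mul_pow, h2, ← Finset.mul_sum]
    have h3 := add_sq_le (a := g.Deps ε (ε • v.grad x) x i j₀)
      (b := gradient g.ζ (hor x) j₀ * v.grad x i (Fin.last d))
    have h4 : (gradient g.ζ (hor x) j₀ * v.grad x i (Fin.last d)) ^ 2
        ≤ B ^ 2 * v.grad x i (Fin.last d) ^ 2 := by
      rw [mul_pow]
      exact mul_le_mul_of_nonneg_right hζ2 (sq_nonneg _)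
    linarith
  have hX : 0 ≤ ∫ x in g.Ω₂, ∑ i, ∑ j, (g.Deps ε (ε • v.grad x) x i j) ^ 2 :=
    integral_nonneg fun x => Finset.sum_nonneg fun i _ => Finset.sum_nonneg fun j _ => sq_nonneg _
  have hA : 0 ≤ ∫ x in g.Ω₂, ‖gradCol (v.grad x) (Fin.last d)‖ ^ 2 :=
    integral_nonneg fun x => by positivity
  calc _ ≤ ε ^ 2 * (R ^ 2 * _) := mul_le_mul_of_nonneg_left (hP v.isLateralH1) (by positivity)
    _ = R ^ 2 * (ε ^ 2 * _) := by ring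
    _ ≤ R ^ 2 * _ := mul_le_mul_of_nonneg_left hle (by positivity)
    _ ≤ _ := by
      rw [mul_assoc (R ^ 2)]
      refine mul_le_mul_of_nonneg_left ?_ (by positivity)
      nlinarith [mul_nonneg (sq_nonneg B) hX]

theorem integral_surfaceMeasure_le {M : ℝ} (hM : 0 ≤ M)
    (hle : g.surfaceMeasure ≤ ENNReal.ofReal M • volume.restrict g.G) {f F : Vec d → ℝ}
    (hf : 0 ≤ f) (hF : Integrable F (volume.restrict g.G))
    (hfF : ∀ᵐ y ∂volume.restrict g.G, f y ≤ F y) :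
    ∫ y, f y ∂g.surfaceMeasure ≤ M * ∫ y in g.G, F y := by
  have h1 : Integrable F (ENNReal.ofReal M • volume.restrict g.G) :=
    hF.smul_measure ENNReal.ofReal_ne_top
  have h2 := g.surfaceMeasure_absolutelyContinuous.ae_le hfF
  have h3 : 0 ≤ᵐ[ENNReal.ofReal M • volume.restrict g.G] F :=
    Measure.smul_absolutelyContinuous.ae_le (hfF.mono fun y hy => (hf y).trans hy)
  calc _ ≤ ∫ y, F y ∂g.surfaceMeasure :=
        integral_mono_of_nonneg (Eventually.of_forall hf) (h1.mono_measure hle) h2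
    _ ≤ ∫ y, F y ∂(ENNReal.ofReal M • volume.restrict g.G) := integral_mono_measure hle h3 h1
    _ = _ := by rw [integral_smul_measure, ENNReal.toReal_ofReal hM, smul_eq_mul]

/-- The normal trace on `Γ` is controlled by the vertical derivative alone: the normal does not
depend on the height, and the normal component vanishes on the top of the channel. -/
theorem Velocity.integral_normalTrace_sq_le {M : ℝ} (hM : 0 ≤ M)
    (hle : g.surfaceMeasure ≤ ENNReal.ofReal M • volume.restrict g.G) (v : g.Velocity) :
    ∫ y, (v.normalTrace y) ^ 2 ∂g.surfaceMeasure
      ≤ M * ∫ x in g.Ω₂, ‖gradCol (v.grad x) (Fin.last d)‖ ^ 2 := by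
  refine (integral_surfaceMeasure_le hM hle (fun y => sq_nonneg _)
    ((v.isLateralH1.2.2.1.sub v.isLateralH1.2.2.2.1).integrable_norm_pow (by norm_num)) ?_).trans
    (mul_le_mul_of_nonneg_left v.isLateralH1.integral_sq_trace_sub_le hM)
  filter_upwards [v.topTrace_normal] with y hy
  have h1 : v.normalTrace y = inner ℝ (v.trace y - v.topTrace y) (g.normal y) := by
    rw [inner_sub_left, hy, sub_zero, normalTrace]
  have h2 := abs_real_inner_le_norm (v.trace y - v.topTrace y) (g.normal y)
  rw [g.norm_normal, mul_one] at h2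
  rw [h1, ← sq_abs]
  exact pow_le_pow_left₀ (abs_nonneg _) h2 2

theorem Velocity.sum_tangTrace_sq_le (v : g.Velocity) {y : Vec d} (hy : y ∈ g.G) :
    ∑ i, (v.tangTrace L y i) ^ 2 ≤ ‖v.trace y‖ ^ 2 := by
  have := (L.orthonormal_ν y hy).sum_inner_products_le (v.trace y) (s := Finset.univ)
  simpa [tangTrace, real_inner_comm] using this

theorem Velocity.integral_tangTrace_sq_le {M : ℝ} (hM : 0 ≤ M)
    (hle : g.surfaceMeasure ≤ ENNReal.ofReal M • volume.restrict g.G) (v : g.Velocity) :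
    ∫ y, ∑ i, (v.tangTrace L y i) ^ 2 ∂g.surfaceMeasure
      ≤ M * (2 * (∫ x in g.Ω₂, ‖v.val x‖ ^ 2)
        + 2 * ∫ x in g.Ω₂, ‖gradCol (v.grad x) (Fin.last d)‖ ^ 2) := by
  refine (integral_surfaceMeasure_le hM hle (fun y => Finset.sum_nonneg fun i _ => sq_nonneg _)
    (v.isLateralH1.2.2.1.integrable_norm_pow (by norm_num)) ?_).trans
    (mul_le_mul_of_nonneg_left v.isLateralH1.integral_sq_trace_le hM)
  filter_upwards [ae_restrict_mem g.isOpen_G.measurableSet] with y hy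
  exact v.sum_tangTrace_sq_le L hy

/-! ### The friction term on the interface -/

theorem Coefficients.exists_norm_Q_le : ∃ K : ℝ, 0 < K ∧ ∀ x ∈ g.Ω₁ ∪ g.Γ, ∀ ξ : Vec (d + 1),
    ‖Matrix.toEuclideanLin (c.Q x) ξ‖ ≤ K * ‖ξ‖ := by
  obtain ⟨M, hM⟩ := c.Q_bounded
  refine ⟨max 1 (((d + 1 : ℕ) : ℝ) * (((d + 1 : ℕ) : ℝ) * M)), by positivity, fun x hx ξ => ?_⟩
  exact (norm_toEuclideanLin_le (hM x hx) ξ).trans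
    (mul_le_mul_of_nonneg_right (le_max_right _ _) (norm_nonneg _))

theorem mkPt_mem_Γ {y : Vec d} (hy : y ∈ g.G) : mkPt y (g.ζ y) ∈ g.Γ := ⟨y, hy, rfl⟩

theorem Coefficients.Q_nonneg {x : Vec (d + 1)} (hx : x ∈ g.Ω₁ ∪ g.Γ) : 0 ≤ c.Q x := by
  obtain ⟨k, hk, hQ⟩ := c.Q_elliptic
  exact nonneg_of_elliptic (c.Q_symm x hx) hk (hQ x hx)

/-- The integrand of the friction term, `β √Q v_τ · v_τ`. -/
noncomputable def Velocity.friction (v : g.Velocity) (y : Vec d) : ℝ :=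
  c.β y * ∑ i, (∑ j, c.sqrtTang L y i j * v.tangTrace L y j) * v.tangTrace L y i

theorem Velocity.friction_nonneg (v : g.Velocity) :
    ∀ᵐ y ∂g.surfaceMeasure, 0 ≤ v.friction c L y := by
  refine g.surfaceMeasure_absolutelyContinuous.ae_le ?_
  filter_upwards [c.β_nonneg] with y hβ
  refine mul_nonneg hβ ?_
  rw [sqrtTang_form]
  exact form_nonneg (CFC.sqrt_nonneg _) _

theorem Velocity.norm_sq_tang (v : g.Velocity) {y : Vec d} (hy : y ∈ g.G) :
    ‖∑ i, v.tangTrace L y i • L.ν i y‖ ^ 2 = ∑ i, (v.tangTrace L y i) ^ 2 := by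
  rw [← real_inner_self_eq_norm_sq, (L.orthonormal_ν y hy).inner_sum]
  simp [sq]

theorem aestronglyMeasurable_ν (i : Fin d) :
    AEStronglyMeasurable (L.ν i) (volume.restrict g.G) :=
  (L.contDiffOn_ν i).continuousOn.aestronglyMeasurable g.isOpen_G.measurableSet

theorem Coefficients.aestronglyMeasurable_sqrtTang (i j : Fin d) :
    AEStronglyMeasurable (fun y => c.sqrtTang L y i j) (volume.restrict g.G) := by
  obtain ⟨S, hS, hSQ⟩ := exists_measurable_sqrt (d + 1)
  have hgraph : AEMeasurable (fun y => mkPt y (g.ζ y)) (volume.restrict g.G) := by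
    have := (aestronglyMeasurable_comp_graph (g := g) continuous_id 0).aemeasurable
    simpa using this
  have hQ : AEMeasurable (fun y i j => c.Q (mkPt y (g.ζ y)) i j) (volume.restrict g.G) :=
    aemeasurable_pi_lambda _ fun i => aemeasurable_pi_lambda _ fun j =>
      (c.measurable_Q i j).comp_aemeasurable hgraph
  have hsqrt : ∀ i j, AEMeasurable (fun y => CFC.sqrt (c.Q (mkPt y (g.ζ y))) i j)
      (volume.restrict g.G) := by
    intro i j
    have h1 : Measurable fun A => S A i j := (measurable_pi_apply j).comp
      ((measurable_pi_apply i).comp hS)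
    refine (h1.comp_aemeasurable hQ).congr ?_
    filter_upwards [ae_restrict_mem g.isOpen_G.measurableSet] with y hy
    exact (hSQ _ (c.Q_nonneg (Or.inr (mkPt_mem_Γ hy))) i j).symm
  exact (aestronglyMeasurable_toEuclideanLin hsqrt (aestronglyMeasurable_ν L j)).inner
    (aestronglyMeasurable_ν L i)

/-- Integrability of the friction term, without which its integral would be the junk value zero
and would not bound the tangential trace. -/
theorem Velocity.integrable_friction (v : g.Velocity) :
    Integrable (v.friction c L) g.surfaceMeasure := by
  obtain ⟨K, hK, hQ⟩ := c.exists_norm_Q_le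
  obtain ⟨B, hB⟩ := c.β_bounded
  obtain ⟨M, hM, hle⟩ := g.exists_surfaceMeasure_le
  suffices Integrable (v.friction c L) (volume.restrict g.G) from
    (this.smul_measure ENNReal.ofReal_ne_top).mono_measure hle
  have htang : ∀ i, AEStronglyMeasurable (fun y => v.tangTrace L y i) (volume.restrict g.G) :=
    fun i => v.isLateralH1.2.2.1.1.inner (aestronglyMeasurable_ν L i)
  have hmeas : AEStronglyMeasurable (v.friction c L) (volume.restrict g.G) := by
    refine c.aemeasurable_β.aestronglyMeasurable.mul ?_
    refine Finset.aestronglyMeasurable_fun_sum _ fun i _ => AEStronglyMeasurable.mul ?_ (htang i)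
    exact Finset.aestronglyMeasurable_fun_sum _ fun j _ =>
      (c.aestronglyMeasurable_sqrtTang L i j).mul (htang j)
  have hint : Integrable (fun y => B * (Real.sqrt K * ‖v.trace y‖ ^ 2)) (volume.restrict g.G) :=
    ((v.isLateralH1.2.2.1.integrable_norm_pow (by norm_num)).const_mul _).const_mul _
  refine hint.mono' hmeas ?_
  filter_upwards [ae_restrict_mem g.isOpen_G.measurableSet, c.β_nonneg, hB] with y hy hβ hβB
  have hmem : mkPt y (g.ζ y) ∈ g.Ω₁ ∪ g.Γ := Or.inr (mkPt_mem_Γ hy)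
  have h1 := norm_sqrt_le (c.Q_nonneg hmem) hK.le (hQ _ hmem)
    (∑ i, v.tangTrace L y i • L.ν i y)
  have h2 := v.sum_tangTrace_sq_le L hy
  rw [← v.norm_sq_tang L hy] at h2
  rw [friction, norm_mul, Real.norm_of_nonneg hβ, sqrtTang_form]
  refine mul_le_mul hβB ?_ (norm_nonneg _) (hβ.trans hβB)
  refine (norm_inner_le_norm _ _).trans ?_
  have h3 := mul_le_mul_of_nonneg_right h1 (norm_nonneg (∑ i, v.tangTrace L y i • L.ν i y))
  rw [mul_assoc, ← sq] at h3
  exact h3.trans (mul_le_mul_of_nonneg_left h2 (Real.sqrt_nonneg _))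

/-- When `β` is bounded below, so is the friction term, since `√Q` is uniformly elliptic. -/
theorem Coefficients.exists_integral_friction_ge {b : ℝ} (hb : 0 < b)
    (hβ : ∀ᵐ y ∂volume.restrict g.G, b ≤ c.β y) : ∃ κ : ℝ, 0 < κ ∧ ∀ v : g.Velocity,
      κ * (∫ y, ∑ i, (v.tangTrace L y i) ^ 2 ∂g.surfaceMeasure)
        ≤ ∫ y, v.friction c L y ∂g.surfaceMeasure := by
  obtain ⟨K, hK, hQ⟩ := c.exists_norm_Q_le
  obtain ⟨k, hk, hQk⟩ := c.Q_elliptic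
  have hs : 0 < Real.sqrt K := Real.sqrt_pos.2 hK
  refine ⟨b * (k / Real.sqrt K), by positivity, fun v => ?_⟩
  rw [← integral_const_mul]
  refine integral_mono_of_nonneg (Eventually.of_forall fun y => ?_) (v.integrable_friction c L) ?_
  · exact mul_nonneg (by positivity) (Finset.sum_nonneg fun i _ => sq_nonneg _)
  · refine g.surfaceMeasure_absolutelyContinuous.ae_le ?_
    filter_upwards [ae_restrict_mem g.isOpen_G.measurableSet, hβ] with y hy hβy
    have hmem : mkPt y (g.ζ y) ∈ g.Ω₁ ∪ g.Γ := Or.inr (mkPt_mem_Γ hy)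
    have h1 := le_form_sqrt (c.Q_nonneg hmem) hK (hQk _ hmem) (hQ _ hmem)
      (∑ i, v.tangTrace L y i • L.ν i y)
    rw [v.norm_sq_tang L hy] at h1
    rw [Velocity.friction, sqrtTang_form, mul_assoc]
    exact mul_le_mul hβy h1 (mul_nonneg (by positivity)
      (Finset.sum_nonneg fun i _ => sq_nonneg _)) (hb.le.trans hβy)

/-! ### The a-priori estimates -/

theorem Coefficients.memLp_Q_apply {u : Vec (d + 1) → Vec (d + 1)}
    (hu : MemLp u 2 (volume.restrict g.Ω₁)) :
    MemLp (fun x => Matrix.toEuclideanLin (c.Q x) (u x)) 2 (volume.restrict g.Ω₁) := by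
  obtain ⟨K, hK, hQ⟩ := c.exists_norm_Q_le
  refine hu.of_le_mul (c := K) (aestronglyMeasurable_toEuclideanLin
    (fun i j => (c.measurable_Q i j).aemeasurable) hu.1) ?_
  filter_upwards [ae_restrict_mem g.isOpen_Ω₁.measurableSet] with x hx
  exact hQ x (Or.inl hx) _

/-- The pressure in the porous medium is controlled by the velocity there: the momentum equation is
tested with a field that vanishes in the channel and has divergence `p` in the porous medium. -/
theorem Coefficients.exists_integral_pressure_sq_le : ∃ C : ℝ, 0 ≤ C ∧
    ∀ (ε : ℝ) (f : Vec (d + 1) → Vec (d + 1)) (h : Vec (d + 1) → ℝ) (v : g.Velocity)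
      (p : Vec (d + 1) → ℝ), g.IsSolution c L ε f h v p →
        ∫ x in g.Ω₁, p x ^ 2 ≤ C * ∫ x in g.Ω₁, ‖v.val x‖ ^ 2 := by
  obtain ⟨R, hR, hw⟩ := g.exists_velocity_div_eq
  obtain ⟨K, hK, hQ⟩ := c.exists_norm_Q_le
  refine ⟨(R ^ 2 + 1) * K ^ 2, by positivity, fun ε f h v p hs => ?_⟩
  have hp : MemLp p 2 (volume.restrict g.Ω₁) :=
    hs.memLp_p.mono_measure (Measure.restrict_mono g.Ω₁_subset le_rfl)
  obtain ⟨w, hwp, hdiv, hzero, hgrad, htr⟩ := hw p hp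
  have hm := hs.momentum w
  have h1 : ∫ x in g.Ω₁, p x * w.div x = ∫ x in g.Ω₁, p x ^ 2 := by
    refine setIntegral_congr_fun g.isOpen_Ω₁.measurableSet fun x hx => ?_
    simp only [hdiv x hx, sq]
  have h2 : ∫ x in g.Ω₂, inner ℝ (f x) (w.val x) = 0 := by
    rw [← integral_zero (Vec (d + 1)) ℝ (μ := volume.restrict g.Ω₂)]
    refine setIntegral_congr_fun g.isOpen_Ω₂.measurableSet fun x hx => ?_
    simp only [hzero x hx, inner_zero_right]
  have h3 : ∀ y, w.normalTrace y = 0 := fun y => by simp [Velocity.normalTrace, htr]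
  have h4 : ∀ y i, w.tangTrace L y i = 0 := fun y i => by simp [Velocity.tangTrace, htr]
  rw [h1, h2] at hm
  simp only [h3, h4, hgrad, divIntegral, contract, Deps, Pi.zero_apply, Matrix.zero_apply, mul_zero,
    zero_mul, add_zero, Finset.sum_const_zero, integral_zero, sub_zero] at hm
  have hy := integral_inner_le_young (c.memLp_Q_apply v.memLp_val_Ω₁) w.memLp_val_Ω₁
    (δ := (2 * (R ^ 2 + 1))⁻¹) (by positivity)
  -- With this weight the term of `w` is at most half of the squared norm of the pressure.
  have hQv : ∫ x in g.Ω₁, ‖Matrix.toEuclideanLin (c.Q x) (v.val x)‖ ^ 2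
      ≤ K ^ 2 * ∫ x in g.Ω₁, ‖v.val x‖ ^ 2 := by
    rw [← integral_const_mul]
    refine integral_mono_of_nonneg (Eventually.of_forall fun x => by positivity)
      ((v.memLp_val_Ω₁.integrable_norm_pow (by norm_num)).const_mul _) ?_
    filter_upwards [ae_restrict_mem g.isOpen_Ω₁.measurableSet] with x hx
    rw [← mul_pow]
    exact pow_le_pow_left₀ (norm_nonneg _) (hQ x (Or.inl hx) _) 2
  have hP0 : 0 ≤ ∫ x in g.Ω₁, p x ^ 2 := integral_nonneg fun x => sq_nonneg _
  have hform : ∫ x in g.Ω₁, form (c.Q x) (v.val x) (w.val x)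
      = ∫ x in g.Ω₁, inner ℝ (Matrix.toEuclideanLin (c.Q x) (v.val x)) (w.val x) := rfl
  rw [← hform] at hy
  have h5 : (4 * (2 * (R ^ 2 + 1))⁻¹)⁻¹ = (R ^ 2 + 1) / 2 := by field_simp; norm_num
  have h6 : (2 * (R ^ 2 + 1))⁻¹ * (∫ x in g.Ω₁, ‖w.val x‖ ^ 2) ≤ (∫ x in g.Ω₁, p x ^ 2) / 2 := by
    rw [inv_mul_le_iff₀ (by positivity)]
    nlinarith
  rw [h5] at hy
  have h7 : (R ^ 2 + 1) / 2 * (∫ x in g.Ω₁, ‖Matrix.toEuclideanLin (c.Q x) (v.val x)‖ ^ 2)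
      ≤ (R ^ 2 + 1) / 2 * (K ^ 2 * ∫ x in g.Ω₁, ‖v.val x‖ ^ 2) :=
    mul_le_mul_of_nonneg_left hQv (by positivity)
  linarith

theorem deps_smul (ε : ℝ) (A : Matrix (Fin (d + 1)) (Fin (d + 1)) ℝ) (x : Vec (d + 1))
    (i : Fin (d + 1)) (j : Fin d) : g.Deps ε (ε • A) x i j = ε * g.Deps ε A x i j := by
  simp only [Deps, Matrix.smul_apply, smul_eq_mul]
  ring

/-- The energy identity: the solution itself is an admissible test function, and the mass equation
replaces the pressure terms by the work of the fluid source. -/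
theorem IsSolution.energy_identity {ε : ℝ} {f : Vec (d + 1) → Vec (d + 1)} {h : Vec (d + 1) → ℝ}
    {v : g.Velocity} {p : Vec (d + 1) → ℝ} (hs : g.IsSolution c L ε f h v p) :
    (∫ x in g.Ω₁, form (c.Q x) (v.val x) (v.val x))
      + c.μ * ((∫ x in g.Ω₂, ∑ i, ∑ j, (g.Deps ε (ε • v.grad x) x i j) ^ 2)
        + ∫ x in g.Ω₂, ‖gradCol (v.grad x) (Fin.last d)‖ ^ 2)
      + (∫ y, c.α y * (v.normalTrace y * v.normalTrace y) ∂g.surfaceMeasure)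
      + ε ^ 2 * (∫ y, v.friction c L y ∂g.surfaceMeasure)
      = ε * (∫ x in g.Ω₂, inner ℝ (f x) (v.val x)) + ∫ x in g.Ω₁, h x * p x := by
  have h1 := hs.momentum v
  have h2 := hs.mass p hs.memLp_p
  have h3 : ∫ x in g.Ω₁, p x * v.div x = ∫ x in g.Ω₁, v.div x * p x := by simp only [mul_comm]
  have h4 : ε ^ 2 * (∫ x in g.Ω₂, c.μ * contract (g.Deps ε (v.grad x) x) (g.Deps ε (v.grad x) x))
      = c.μ * ∫ x in g.Ω₂, ∑ i, ∑ j, (g.Deps ε (ε • v.grad x) x i j) ^ 2 := by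
    rw [← integral_const_mul, ← integral_const_mul]
    refine integral_congr_ae (Eventually.of_forall fun x => ?_)
    simp only [contract, deps_smul, Finset.mul_sum]
    exact Finset.sum_congr rfl fun i _ => Finset.sum_congr rfl fun j _ => by ring
  have h5 : (∫ x in g.Ω₂, c.μ *
        ∑ j : Fin d, v.grad x j.castSucc (Fin.last d) * v.grad x j.castSucc (Fin.last d))
      = c.μ * ∫ x in g.Ω₂, ∑ j : Fin d, (v.grad x j.castSucc (Fin.last d)) ^ 2 := by
    simp only [integral_const_mul, sq]
  have h6 : (∫ x in g.Ω₂, c.μ *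
        (v.grad x (Fin.last d) (Fin.last d) * v.grad x (Fin.last d) (Fin.last d)))
      = c.μ * ∫ x in g.Ω₂, (v.grad x (Fin.last d) (Fin.last d)) ^ 2 := by
    simp only [integral_const_mul, sq]
  have h7 : (∫ y, c.β y * ∑ i, (∑ j, c.sqrtTang L y i j * v.tangTrace L y j) * v.tangTrace L y i
      ∂g.surfaceMeasure) = ∫ y, v.friction c L y ∂g.surfaceMeasure := rfl
  rw [h3, h4, h5, h6, h7] at h1
  rw [v.integral_gradCol_last]
  linarith

/-- The uniform bound for the terms of the energy that are controlled by the dissipation. -/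
theorem Coefficients.exists_dissipation_le (hd : 1 ≤ d)
    (f : ℝ → Vec (d + 1) → Vec (d + 1)) (h : ℝ → Vec (d + 1) → ℝ) (C : ℝ)
    (hf : ∀ ε : ℝ, 0 < ε → MemLp (f ε) 2 (volume.restrict g.Ω₂) ∧
      eLpNorm (f ε) 2 (volume.restrict g.Ω₂) ≤ ENNReal.ofReal C)
    (hh : ∀ ε : ℝ, 0 < ε → MemLp (h ε) 2 (volume.restrict g.Ω₁) ∧
      eLpNorm (h ε) 2 (volume.restrict g.Ω₁) ≤ ENNReal.ofReal C) :
    ∃ K : ℝ, 0 ≤ K ∧ ∀ ε : ℝ, 0 < ε → ∀ (v : g.Velocity) (p : Vec (d + 1) → ℝ),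
      g.IsSolution c L ε (f ε) (h ε) v p →
        (∫ x in g.Ω₁, ‖v.val x‖ ^ 2) ≤ K ∧
        (∫ x in g.Ω₂, ∑ i, ∑ j, (g.Deps ε (ε • v.grad x) x i j) ^ 2)
          + (∫ x in g.Ω₂, ‖gradCol (v.grad x) (Fin.last d)‖ ^ 2) ≤ K ∧
        ε ^ 2 * (∫ y, v.friction c L y ∂g.surfaceMeasure) ≤ K := by
  obtain ⟨Cp, hCp, hP⟩ := c.exists_integral_pressure_sq_le L
  obtain ⟨Cv, hCv, hV⟩ := exists_sq_mul_integral_sq_le hd g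
  obtain ⟨k, hk, hQk⟩ := c.Q_elliptic
  have hμ := c.μ_pos
  set F := max C 0 ^ 2 with hF
  have hC : ENNReal.ofReal C ≤ ENNReal.ofReal (max C 0) :=
    ENNReal.ofReal_le_ofReal (le_max_left _ _)
  -- The constant collects the terms of Young's inequality that are not absorbed; the weights are
  -- chosen such that the other terms amount to at most half of the dissipation.
  set K₀ := (Cv + 1) / (2 * c.μ) * F + (Cp + 1) / (2 * k) * F with hK₀
  have hK₀0 : 0 ≤ K₀ := by positivity
  have hK1 : 0 ≤ 2 * K₀ / k := by positivity
  have hK2 : 0 ≤ 2 * K₀ / c.μ := by positivity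
  refine ⟨2 * K₀ / k + 2 * K₀ / c.μ + K₀, by positivity, fun ε hε v p hs => ?_⟩
  have hid := hs.energy_identity
  set N := ∫ x in g.Ω₁, ‖v.val x‖ ^ 2
  set X := (∫ x in g.Ω₂, ∑ i, ∑ j, (g.Deps ε (ε • v.grad x) x i j) ^ 2)
          + (∫ x in g.Ω₂, ‖gradCol (v.grad x) (Fin.last d)‖ ^ 2)
  set T := ε ^ 2 * (∫ y, v.friction c L y ∂g.surfaceMeasure)
  have hp : MemLp p 2 (volume.restrict g.Ω₁) :=
    hs.memLp_p.mono_measure (Measure.restrict_mono g.Ω₁_subset le_rfl)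
  have hN : 0 ≤ N := integral_nonneg fun x => by positivity
  have hX : 0 ≤ X := add_nonneg
    (integral_nonneg fun x => Finset.sum_nonneg fun i _ => Finset.sum_nonneg fun j _ => sq_nonneg _)
    (integral_nonneg fun x => by positivity)
  have hT : 0 ≤ T := mul_nonneg (sq_nonneg ε) (integral_nonneg_of_ae (v.friction_nonneg c L))
  have hα : 0 ≤ ∫ y, c.α y * (v.normalTrace y * v.normalTrace y) ∂g.surfaceMeasure := by
    refine integral_nonneg_of_ae (g.surfaceMeasure_absolutelyContinuous.ae_le ?_)
    filter_upwards [c.α_nonneg] with y hy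
    exact mul_nonneg hy (mul_self_nonneg _)
  have hQ : k * N ≤ ∫ x in g.Ω₁, form (c.Q x) (v.val x) (v.val x) := by
    rw [← integral_const_mul]
    refine integral_mono_of_nonneg (Eventually.of_forall fun x => by positivity)
      (integrable_inner_of_memLp (c.memLp_Q_apply v.memLp_val_Ω₁) v.memLp_val_Ω₁) ?_
    filter_upwards [ae_restrict_mem g.isOpen_Ω₁.measurableSet] with x hx
    exact hQk x (Or.inl hx) _
  have hfF : ∫ x in g.Ω₂, ‖f ε x‖ ^ 2 ≤ F :=
    integral_norm_sq_le_of_eLpNorm_le (le_max_right _ _) (hf ε hε).1 ((hf ε hε).2.trans hC)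
  have hhF : ∫ x in g.Ω₁, ‖h ε x‖ ^ 2 ≤ F :=
    integral_norm_sq_le_of_eLpNorm_le (le_max_right _ _) (hh ε hε).1 ((hh ε hε).2.trans hC)
  have hforce : ε * (∫ x in g.Ω₂, inner ℝ (f ε x) (v.val x))
      ≤ (Cv + 1) / (2 * c.μ) * F + c.μ / 2 * X := by
    have h1 := integral_inner_le_young (hf ε hε).1 (v.isLateralH1.1.const_smul ε)
      (δ := c.μ / (2 * (Cv + 1))) (by positivity)
    have h2 : ∫ x in g.Ω₂, inner ℝ (f ε x) ((ε • v.val) x)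
        = ε * ∫ x in g.Ω₂, inner ℝ (f ε x) (v.val x) := by
      rw [← integral_const_mul]
      simp only [Pi.smul_apply, real_inner_smul_right]
    have h3 : ∫ x in g.Ω₂, ‖(ε • v.val) x‖ ^ 2 = ε ^ 2 * ∫ x in g.Ω₂, ‖v.val x‖ ^ 2 := by
      rw [← integral_const_mul]
      simp only [Pi.smul_apply, norm_smul, mul_pow, Real.norm_eq_abs, sq_abs]
    have h4 : (4 * (c.μ / (2 * (Cv + 1))))⁻¹ = (Cv + 1) / (2 * c.μ) := by field_simp; norm_num
    rw [h2, h3, h4] at h1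
    refine h1.trans (add_le_add (mul_le_mul_of_nonneg_left hfF (by positivity)) ?_)
    calc _ ≤ c.μ / (2 * (Cv + 1)) * (Cv * X) :=
          mul_le_mul_of_nonneg_left (hV ε hε v) (by positivity)
      _ ≤ c.μ / (2 * (Cv + 1)) * ((Cv + 1) * X) := by gcongr; linarith
      _ = _ := by field_simp
  have hsource : ∫ x in g.Ω₁, h ε x * p x ≤ (Cp + 1) / (2 * k) * F + k / 2 * N := by
    have h1 := integral_inner_le_young (hh ε hε).1 hp (δ := k / (2 * (Cp + 1))) (by positivity)
    have h2 : ∫ x in g.Ω₁, inner ℝ (h ε x) (p x) = ∫ x in g.Ω₁, h ε x * p x := by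
      simp [mul_comm]
    have h3 : ∫ x in g.Ω₁, ‖p x‖ ^ 2 = ∫ x in g.Ω₁, p x ^ 2 := by simp
    have h4 : (4 * (k / (2 * (Cp + 1))))⁻¹ = (Cp + 1) / (2 * k) := by field_simp; norm_num
    rw [h2, h3, h4] at h1
    refine h1.trans (add_le_add (mul_le_mul_of_nonneg_left hhF (by positivity)) ?_)
    calc _ ≤ k / (2 * (Cp + 1)) * (Cp * N) :=
          mul_le_mul_of_nonneg_left (hP ε _ _ v p hs) (by positivity)
      _ ≤ k / (2 * (Cp + 1)) * ((Cp + 1) * N) := by gcongr; linarith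
      _ = _ := by field_simp
  have hkN : 0 ≤ k * N := by positivity
  have hμX : 0 ≤ c.μ * X := by positivity
  have hN' : N ≤ 2 * K₀ / k := by
    rw [le_div_iff₀ hk]; linarith
  have hX' : X ≤ 2 * K₀ / c.μ := by
    rw [le_div_iff₀ hμ]; linarith
  exact ⟨by linarith, by linarith, by linarith⟩

/-- The energy is bounded by the dissipative terms and the tangential trace. -/
theorem energy_le {M K T ε : ℝ} (hM : 0 ≤ M)
    (hle : g.surfaceMeasure ≤ ENNReal.ofReal M • volume.restrict g.G) (v : g.Velocity)
    (hN : (∫ x in g.Ω₁, ‖v.val x‖ ^ 2) ≤ K)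
    (hX : (∫ x in g.Ω₂, ∑ i, ∑ j, (g.Deps ε (ε • v.grad x) x i j) ^ 2)
          + (∫ x in g.Ω₂, ‖gradCol (v.grad x) (Fin.last d)‖ ^ 2) ≤ K)
    (hT : ε ^ 2 * (∫ y, ∑ i, (v.tangTrace L y i) ^ 2 ∂g.surfaceMeasure) ≤ T) :
    g.energy L ε v ≤ 2 * K + M * K + T := by
  have h1 := v.integral_normalTrace_sq_le hM hle
  have hD : 0 ≤ ∫ x in g.Ω₂, ∑ i, ∑ j, (g.Deps ε (ε • v.grad x) x i j) ^ 2 :=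
    integral_nonneg fun x => Finset.sum_nonneg fun i _ => Finset.sum_nonneg fun j _ => sq_nonneg _
  have h2 : M * (∫ x in g.Ω₂, ‖gradCol (v.grad x) (Fin.last d)‖ ^ 2) ≤ M * K :=
    mul_le_mul_of_nonneg_left (by linarith) hM
  have h3 : ∫ y, ∑ i, (ε * v.tangTrace L y i) ^ 2 ∂g.surfaceMeasure
      = ε ^ 2 * ∫ y, ∑ i, (v.tangTrace L y i) ^ 2 ∂g.surfaceMeasure := by
    simp only [mul_pow, ← Finset.mul_sum, integral_const_mul]
  rw [v.integral_gradCol_last] at hX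
  rw [energy, h3]
  linarith

end Geometry

end DarcyStokes

theorem mainTheorem6 {d : ℕ} (hd : 1 ≤ d) (g : DarcyStokes.Geometry d)
    (c : g.Coefficients) (L : g.Localizer)
    (f : ℝ → DarcyStokes.Vec (d + 1) → DarcyStokes.Vec (d + 1))
    (h : ℝ → DarcyStokes.Vec (d + 1) → ℝ) (C : ℝ)
    (hf : ∀ ε : ℝ, 0 < ε → MemLp (f ε) 2 (volume.restrict g.Ω₂) ∧
      eLpNorm (f ε) 2 (volume.restrict g.Ω₂) ≤ ENNReal.ofReal C)
    (hh : ∀ ε : ℝ, 0 < ε → MemLp (h ε) 2 (volume.restrict g.Ω₁) ∧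
      eLpNorm (h ε) 2 (volume.restrict g.Ω₁) ≤ ENNReal.ofReal C) :
    (∀ ε₀ : ℝ, 0 < ε₀ → ∃ K : ℝ, 0 < K ∧ ∀ ε : ℝ, 0 < ε → ε ≤ ε₀ →
      ∀ (v : g.Velocity) (p : DarcyStokes.Vec (d + 1) → ℝ),
        g.IsSolution c L ε (f ε) (h ε) v p → g.energy L ε v ≤ K) ∧
    ((∃ b : ℝ, 0 < b ∧ ∀ᵐ y ∂volume.restrict g.G, b ≤ c.β y) →
      ∃ K : ℝ, 0 < K ∧ ∀ ε : ℝ, 0 < ε →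
        ∀ (v : g.Velocity) (p : DarcyStokes.Vec (d + 1) → ℝ),
          g.IsSolution c L ε (f ε) (h ε) v p → g.energy L ε v ≤ K) := by
  obtain ⟨K, hK, hdiss⟩ := c.exists_dissipation_le L hd f h C hf hh
  obtain ⟨M, hM, hle⟩ := g.exists_surfaceMeasure_le
  obtain ⟨Cv, hCv, hV⟩ := DarcyStokes.Geometry.exists_sq_mul_integral_sq_le hd g
  refine ⟨fun ε₀ hε₀ => ?_, fun ⟨b, hb, hβ⟩ => ?_⟩
  -- For `ε ≤ ε₀` the trace of `ε v` is controlled by `ε v` and `ε₀ ∂_z v`.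
  · refine ⟨2 * K + M * K + M * (2 * (Cv * K) + 2 * (ε₀ ^ 2 * K)) + 1, by positivity,
      fun ε hε hεε₀ v p hs => ?_⟩
    obtain ⟨hN, hX, -⟩ := hdiss ε hε v p hs
    refine (DarcyStokes.Geometry.energy_le L hM hle v hN hX
      (T := M * (2 * (Cv * K) + 2 * (ε₀ ^ 2 * K))) ?_).trans
      (by linarith)
    have hD : 0 ≤ ∫ x in g.Ω₂, ∑ i, ∑ j, (g.Deps ε (ε • v.grad x) x i j) ^ 2 :=
      integral_nonneg fun x => Finset.sum_nonneg fun i _ => Finset.sum_nonneg fun j _ => sq_nonneg _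
    have h1 := (hV ε hε v).trans (mul_le_mul_of_nonneg_left hX hCv)
    have h2 : ε ^ 2 * (∫ x in g.Ω₂, ‖DarcyStokes.gradCol (v.grad x) (Fin.last d)‖ ^ 2)
        ≤ ε₀ ^ 2 * K :=
      mul_le_mul (pow_le_pow_left₀ hε.le hεε₀ 2) (by linarith)
        (integral_nonneg fun x => by positivity) (by positivity)
    have h3 := mul_le_mul_of_nonneg_left (v.integral_tangTrace_sq_le L hM hle) (sq_nonneg ε)
    have h4 := mul_le_mul_of_nonneg_left (add_le_add (mul_le_mul_of_nonneg_left h1 zero_le_two)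
      (mul_le_mul_of_nonneg_left h2 zero_le_two)) hM
    refine h3.trans (le_trans (le_of_eq ?_) h4)
    ring
  -- For large `ε` the trace of `ε v` is out of reach of `∂_z v`; friction controls it instead.
  · obtain ⟨κ, hκ, hfr⟩ := c.exists_integral_friction_ge L hb hβ
    refine ⟨2 * K + M * K + K / κ + 1, by positivity, fun ε hε v p hs => ?_⟩
    obtain ⟨hN, hX, hT⟩ := hdiss ε hε v p hs
    refine (DarcyStokes.Geometry.energy_le L hM hle v hN hX (T := K / κ) ?_).trans (by linarith)
    rw [le_div_iff₀ hκ]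
    have := mul_le_mul_of_nonneg_left (hfr v) (sq_nonneg ε)
    linarith
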